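/- A loopless mixed graph has a finite node set $V$ and undirected ($i-j$), bidirected ($i\leftrightarrow j$) and directed ($i\to j$) edges between distinct nodes; paths have no repeated nodes. An inner node of a path is a collider on it if both path edges at that node have an arrowhead there. For $C\subseteq V$, a path is $m$-connecting given $C$ if each collider on it lies in $C$ or is an ancestor of a node of $C$ (along directed paths) and all its other nodes, including its endpoints, are outside $C$. The independence model $\mathcal J(\mathcal G)$ is the set of triples $\langle A,B\mid C\rangle$ of subsets of $V$ with $A\cap B=\emptyset$ such that no path between a node of $A$ and a node of $B$ is $m$-connecting given $C$; $\mathcal G,\mathcal H$ on the same node set are Markov equivalent if $\mathcal J(\mathcal G)=\mathcal J(\mathcal H)$. $\mathcal G$ is ancestral if it has no directed cycle, if $i\leftrightarrow j$ implies that there is no directed path from $i$ to $j$ or from $j$ to $i$, and if $i-j$ implies that no edge has an arrowhead at $i$ or $j$. The endpoints of undirected edges are called selection-adjacent. An inducing path between $i$ and $j$ is a path all of whose inner nodes are colliders on it and ancestors of $i$ or $j$. The maximal extension $\overline{\mathcal G}$ of an ancestral graph $\mathcal G$ is obtained by adding $i\leftrightarrow j$ for all distinct nonadjacent $i,j$ that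 are joined by an inducing path in $\mathcal G$. Let $\mathcal I$ be a finite multiset of subsets of $V$ (intervention targets). It doubly-intervenes on $i\in V$ if $i$ lies in two distinct elements of the multiset (two copies of one set count as distinct). The graph $\mathcal G^{\mathcal I}$ is obtained from $\mathcal G$ by adding, for each nonempty element $I$ of $\mathcal I$ (with multiplicity), a new node $\omega_I$ and the edges $\omega_I\to i$ for $i\in I$. $\mathcal G$ and $\mathcal H$ are $\mathcal I$-Markov equivalent if $\mathcal J(\mathcal G^{\mathcal I})=\mathcal J(\mathcal H^{\mathcal I})$. A path $\langle v_0,\dots,v_m,b,c\rangle$ is discriminating for $b$ if $v_0$ and $c$ are nonadjacent and each of $v_1,\dots,v_m$ is a collider on the path and a parent of $c$. A triple is a path $\langle i,j,k\rangle$ on three nodes. It has order $0$ if $i,k$ are nonadjacent. It has order $t+1$ if it has no order $s\le t$ and there is a discriminating path $\langle v_0,\dots,v_m,b,c\rangle$ such that $\langle i,j,k\rangle$ or $\langle k,j,i\rangle$ is $\langle v_m,b,c\rangle$ and each of $\langle v_0,v_1,v_2\rangle,\dots,\langle v_{m-1},v_m,b\rangle$ has some order $s\le t$. A collider with order is a triple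 $\langle i,j,k\rangle$ that has some order and whose two edges have arrowheads at $j$. The $\mathcal I$-colliders with order of $\mathcal G^{\mathcal I}$ are the colliders with order in $\mathcal G^{\mathcal I}$ that are not colliders with order in $\mathcal G$. Theorem. Let $\mathcal G$ and $\mathcal H$ be ancestral graphs on the same finite node set $V$, and let $\mathcal I$ be a finite multiset of subsets of $V$ that doubly-intervenes on no selection-adjacent node of $\mathcal G$ and on no selection-adjacent node of $\mathcal H$. Then the following are equivalent: 1. $\mathcal G$ and $\mathcal H$ are $\mathcal I$-Markov equivalent; 2. $\overline{\mathcal G}$ and $\overline{\mathcal H}$ are $\mathcal I$-Markov equivalent; 3. $\overline{\mathcal G}$ and $\overline{\mathcal H}$ are Markov equivalent, and $\overline{\mathcal G}^{\mathcal I}$ and $\overline{\mathcal H}^{\mathcal I}$ have the same $\mathcal I$-colliders with order. -/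

import Mathlib

/-- A loopless mixed graph on the node set `V`: undirected edges `i - j`, bidirected edges `i ↔ j`
and directed edges `i → j`. Edges of several types between the same two nodes are allowed. -/
structure LMG (V : Type*) where
  und : V → V → Prop
  bi : V → V → Prop
  dir : V → V → Prop
  und_symm : ∀ {i j}, und i j → und j i
  bi_symm : ∀ {i j}, bi i j → bi j i
  und_irrefl : ∀ i, ¬ und i i
  bi_irrefl : ∀ i, ¬ bi i i
  dir_irrefl : ∀ i, ¬ dir i i

/-- The four ways in which an edge can be traversed from a node `u` to a node `v`:
`u - v`, `u ↔ v`, `u → v`, `u ← v`. -/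
inductive EdgeKind where
  | line
  | arc
  | fwd
  | bwd

namespace EdgeKind

/-- The edge has an arrowhead at the node where the traversal starts. -/
def ArrowAtStart : EdgeKind → Prop
  | arc => True
  | bwd => True
  | line => False
  | fwd => False

/-- The edge has an arrowhead at the node where the traversal ends. -/
def ArrowAtEnd : EdgeKind → Prop
  | arc => True
  | fwd => True
  | line => False
  | bwd => False

end EdgeKind

namespace LMG

variable {V : Type*}

/-- The graph `G` has an edge of the given kind from `u` to `v`. -/
def HasEdge (G : LMG V) : EdgeKind → V → V → Prop
  | .line, u, v => G.und u v
  | .arc, u, v => G.bi u v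
  | .fwd, u, v => G.dir u v
  | .bwd, u, v => G.dir v u

/-- Two nodes are adjacent if they are the endpoints of some edge. -/
def Adj (G : LMG V) (u v : V) : Prop :=
  ∃ κ, G.HasEdge κ u v

/-- `i` is an ancestor of `j`: there is a directed path from `i` to `j` with at least one edge. -/
def IsAncestor (G : LMG V) (i j : V) : Prop :=
  Relation.TransGen G.dir i j

/-- The ancestors of the members of a set of nodes. -/
def ancestors (G : LMG V) (C : Set V) : Set V :=
  {i | ∃ j ∈ C, G.IsAncestor i j}

/-- `⟨v 0, e 0, v 1, e 1, …, e (n - 1), v n⟩` is a path (with `n` edges and without repeated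
nodes) in `G`. Values of `v` beyond `n` and of `e` beyond `n - 1` play no role. -/
def IsPath (G : LMG V) (n : ℕ) (v : ℕ → V) (e : ℕ → EdgeKind) : Prop :=
  (∀ k < n, G.HasEdge (e k) (v k) (v (k + 1))) ∧
    ∀ k ≤ n, ∀ l ≤ n, v k = v l → k = l

/-- On a path with edges `e`, the two edges `e k` and `e (k + 1)` at the inner node number `k + 1`
both have an arrowhead at that node. -/
def ColliderAt (e : ℕ → EdgeKind) (k : ℕ) : Prop :=
  (e k).ArrowAtEnd ∧ (e (k + 1)).ArrowAtStart

/-- The path is m-connecting given `C`: every collider on it is in `C` or an ancestor of a member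
of `C`, and all its other nodes, in particular its two endpoints, are outside `C`. -/
def MConnecting (G : LMG V) (C : Set V) (n : ℕ) (v : ℕ → V) (e : ℕ → EdgeKind) : Prop :=
  G.IsPath n v e ∧
    (∀ k, k + 1 < n → ColliderAt e k → v (k + 1) ∈ C ∪ G.ancestors C) ∧
    (∀ k, k + 1 < n → ¬ ColliderAt e k → v (k + 1) ∉ C) ∧
    v 0 ∉ C ∧ v n ∉ C

/-- `C` m-separates `A` and `B`: no path between a node of `A` and a node of `B` is m-connecting
given `C`. -/
def MSeparates (G : LMG V) (A B C : Set V) : Prop :=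
  ∀ n v e, v 0 ∈ A → v n ∈ B → ¬ G.MConnecting C n v e

/-- The formal independence model `J(G)`: the triples `⟨A, B ∣ C⟩` with `A`, `B` disjoint and
m-separated given `C`. -/
def indepModel (G : LMG V) : Set (Set V × Set V × Set V) :=
  {t | Disjoint t.1 t.2.1 ∧ G.MSeparates t.1 t.2.1 t.2.2}

/-- Markov equivalence. -/
def MarkovEquiv (G H : LMG V) : Prop :=
  G.indepModel = H.indepModel

/-- Ancestral graphs. -/
structure IsAncestral (G : LMG V) : Prop where
  no_directed_cycle : ∀ i, ¬ G.IsAncestor i i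
  bi_no_directed_path : ∀ i j, G.bi i j → ¬ G.IsAncestor i j ∧ ¬ G.IsAncestor j i
  und_no_arrowhead : ∀ i j, G.und i j → ∀ k,
    ¬ G.dir k i ∧ ¬ G.bi k i ∧ ¬ G.dir k j ∧ ¬ G.bi k j

/-- Selection adjacent nodes: the endpoints of undirected edges. -/
def SelectionAdjacent (G : LMG V) (i : V) : Prop :=
  ∃ j, G.und i j

/-- An inducing path between `v 0` and `v n`: every inner node is a collider on the path and an
ancestor of at least one of the two endpoints. -/
def IsInducingPath (G : LMG V) (n : ℕ) (v : ℕ → V) (e : ℕ → EdgeKind) : Prop :=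
  G.IsPath n v e ∧
    ∀ k, k + 1 < n → ColliderAt e k ∧
      (G.IsAncestor (v (k + 1)) (v 0) ∨ G.IsAncestor (v (k + 1)) (v n))

/-- There is an inducing path between `i` and `j`, in one of the two directions. -/
def InducingConnected (G : LMG V) (i j : V) : Prop :=
  ∃ n v e, G.IsInducingPath n v e ∧ ((v 0 = i ∧ v n = j) ∨ (v 0 = j ∧ v n = i))

theorem Adj.symm {G : LMG V} {i j : V} (h : G.Adj i j) : G.Adj j i := by
  obtain ⟨κ, h⟩ := h
  cases κ with
  | line => exact ⟨.line, G.und_symm h⟩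
  | arc => exact ⟨.arc, G.bi_symm h⟩
  | fwd => exact ⟨.bwd, h⟩
  | bwd => exact ⟨.fwd, h⟩

/-- The maximal extension of an ancestral graph: a bidirected edge is added between any two
distinct nonadjacent nodes that are the endpoints of an inducing path. -/
def maximalExtension (G : LMG V) : LMG V where
  und := G.und
  dir := G.dir
  bi i j := G.bi i j ∨ (i ≠ j ∧ ¬ G.Adj i j ∧ G.InducingConnected i j)
  und_symm := G.und_symm
  bi_symm := by
    rintro i j (h | ⟨h1, h2, n, v, e, hp, h3⟩)
    · exact Or.inl (G.bi_symm h)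
    · exact Or.inr ⟨h1.symm, fun h => h2 h.symm, n, v, e, hp, h3.symm⟩
  und_irrefl := G.und_irrefl
  bi_irrefl := by
    rintro i (h | h)
    · exact G.bi_irrefl i h
    · exact h.1 rfl
  dir_irrefl := G.dir_irrefl

/-! ### Interventions

A finite multiset of intervention targets is a finite family `T : ι → Set V` of sets of nodes; its
elements, with multiplicity, are the indices. -/

variable {ι : Type*}

/-- The node `i` lies in two distinct elements of the multiset of targets. -/
def DoublyIntervenes (T : ι → Set V) (i : V) : Prop :=
  ∃ k l, k ≠ l ∧ i ∈ T k ∧ i ∈ T l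

/-- The interventional nodes `ω_I`, one for each nonempty element of the multiset of targets. -/
abbrev InterventionNode (T : ι → Set V) : Type _ :=
  {k : ι // (T k).Nonempty}

/-- The directed edges of the interventional graph: those of `G`, and `ω_I → i` for `i ∈ I`. -/
def interventionalDir (G : LMG V) (T : ι → Set V) :
    V ⊕ InterventionNode T → V ⊕ InterventionNode T → Prop
  | .inl i, .inl j => G.dir i j
  | .inr w, .inl j => j ∈ T w.1
  | _, .inr _ => False

/-- A relation on `V`, viewed as a relation on the larger node set. -/
def liftRel (T : ι → Set V) (r : V → V → Prop) :
    V ⊕ InterventionNode T → V ⊕ InterventionNode T → Prop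
  | .inl i, .inl j => r i j
  | _, _ => False

/-- The interventional graph of `G` for the targets `T`. -/
def interventional (G : LMG V) (T : ι → Set V) : LMG (V ⊕ InterventionNode T) where
  und := liftRel T G.und
  bi := liftRel T G.bi
  dir := G.interventionalDir T
  und_symm := by
    rintro (i | i) (j | j) h
    · exact G.und_symm h
    all_goals exact h.elim
  bi_symm := by
    rintro (i | i) (j | j) h
    · exact G.bi_symm h
    all_goals exact h.elim
  und_irrefl := by
    rintro (i | i) h
    · exact G.und_irrefl i h
    · exact h
  bi_irrefl := by
    rintro (i | i) h
    · exact G.bi_irrefl i h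
    · exact h
  dir_irrefl := by
    rintro (i | i) h
    · exact G.dir_irrefl i h
    · exact h

/-- Interventional Markov equivalence for the targets `T`. -/
def IMarkovEquiv (T : ι → Set V) (G H : LMG V) : Prop :=
  (G.interventional T).indepModel = (H.interventional T).indepModel

/-! ### Colliders with order -/

/-- `⟨i, j, k⟩` is a path on three nodes. -/
def IsTriple (G : LMG V) (i j k : V) : Prop :=
  i ≠ k ∧ G.Adj i j ∧ G.Adj j k

/-- `⟨i, j, k⟩` is a path on three nodes whose two edges have an arrowhead at `j`. -/
def IsCollider (G : LMG V) (i j k : V) : Prop :=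
  i ≠ k ∧ (G.dir i j ∨ G.bi i j) ∧ (G.dir k j ∨ G.bi k j)

/-- `⟨v 0, v 1, …, v m, v (m + 1), v (m + 2)⟩` is a discriminating path for `v (m + 1)`: the first
and the last node are nonadjacent, and each of `v 1, …, v m` is a collider on the path and a parent
of the last node. -/
def IsDiscriminatingPath (G : LMG V) (m : ℕ) (v : ℕ → V) (e : ℕ → EdgeKind) : Prop :=
  G.IsPath (m + 2) v e ∧ ¬ G.Adj (v 0) (v (m + 2)) ∧
    ∀ k < m, ColliderAt e k ∧ G.dir (v (k + 1)) (v (m + 2))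

/-- The triples of order at most `t`. -/
def TripleOfOrderLE (G : LMG V) : ℕ → V → V → V → Prop
  | 0, i, j, k => G.IsTriple i j k ∧ ¬ G.Adj i k
  | t + 1, i, j, k => G.TripleOfOrderLE t i j k ∨
      ∃ m v e, G.IsDiscriminatingPath m v e ∧
        (∀ l < m, G.TripleOfOrderLE t (v l) (v (l + 1)) (v (l + 2))) ∧
        ((i = v m ∧ j = v (m + 1) ∧ k = v (m + 2)) ∨
          (k = v m ∧ j = v (m + 1) ∧ i = v (m + 2)))

/-- The triples of order `t`: those of order at most `t` that are of no smaller order. -/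
def TripleOfOrder (G : LMG V) (t : ℕ) (i j k : V) : Prop :=
  G.TripleOfOrderLE t i j k ∧ ∀ s < t, ¬ G.TripleOfOrderLE s i j k

/-- The colliders with order: the colliders that are triples of order `t` for some `t`. -/
def collidersWithOrder (G : LMG V) : Set (V × V × V) :=
  {x | G.IsCollider x.1 x.2.1 x.2.2 ∧ ∃ t, G.TripleOfOrder t x.1 x.2.1 x.2.2}

/-- The interventional colliders with order: the colliders with order in the interventional graph
of `G` that are not colliders with order in `G`. -/
def ICollidersWithOrder (G : LMG V) (T : ι → Set V) :
    Set ((V ⊕ InterventionNode T) × (V ⊕ InterventionNode T) × (V ⊕ InterventionNode T)) :=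
  (G.interventional T).collidersWithOrder \
    (fun x : V × V × V => (Sum.inl x.1, Sum.inl x.2.1, Sum.inl x.2.2)) '' G.collidersWithOrder

end LMG

/-! The core is a characterization for maximal ancestral graphs
(`markovEquiv_iff_collidersWithOrder`): Markov equivalence means equal adjacencies and equal
colliders with order.

For necessity, nonadjacent nodes of a maximal ancestral graph are separated by their ancestors
together with the selection-adjacent nodes, so adjacencies can be read off the model. If `C`
separates the ends of a discriminating path, the discriminated node is a collider exactly when it is
outside `C`. Hence equivalent graphs agree on common discriminating paths (`AgreeOnDiscriminated`),
and induction on the order transfers all triples with order.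

For sufficiency, take a connecting walk with the fewest edges and, among these, the least total
distance from its colliders to the conditioning set. It is a path, and all its triples have order: a
shielded triple could be cut short unless a piece of the walk discriminates it, and maximality keeps
such pieces from supporting each other in a circle. So the other graph has the same colliders on the
path. It also keeps a shortest directed path from each collider to the conditioning set: its first
edge ends a discriminating path, and each later edge completes an unshielded noncollider.

The interventional graph need not be ancestral, because `ω → i - j` may occur. Making `ω → i`
undirected at selection-adjacent `i` repairs this. Such an `i` receives no arrowhead from the
original graph and, not being doubly intervened on, at most one from interventional nodes, so it is
never a collider. The reorientation therefore changes neither the independence model nor the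
colliders with order (`Similar`), and it commutes with the maximal extension. As an ancestral graph
is Markov equivalent to its maximal extension, conditions 1 and 2 agree. Conditions 2 and 3 are
compared by the characterization, applied both to the extensions and to their reoriented
interventional graphs. -/

namespace LMG

variable {V : Type*}

/-! ### Arrowheads in ancestral graphs -/

/-- Some edge between `u` and `v` has an arrowhead at `v`. -/
def Into (G : LMG V) (u v : V) : Prop := G.dir u v ∨ G.bi u v

/-- There is at most one edge between any two nodes. -/
def IsSimple (G : LMG V) : Prop :=
  ∀ ⦃u v κ κ'⦄, G.HasEdge κ u v → G.HasEdge κ' u v → κ = κ'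

theorem adj_iff {G : LMG V} {u v : V} :
    G.Adj u v ↔ G.und u v ∨ G.bi u v ∨ G.dir u v ∨ G.dir v u := by
  constructor
  · rintro ⟨κ, h⟩
    cases κ <;> simp_all [HasEdge]
  · rintro (h | h | h | h)
    exacts [⟨.line, h⟩, ⟨.arc, h⟩, ⟨.fwd, h⟩, ⟨.bwd, h⟩]

theorem not_adj_self (G : LMG V) (u : V) : ¬ G.Adj u u := by
  rw [adj_iff]
  rintro (h | h | h | h)
  exacts [G.und_irrefl _ h, G.bi_irrefl _ h, G.dir_irrefl _ h, G.dir_irrefl _ h]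

theorem Adj.ne {G : LMG V} {u v : V} (h : G.Adj u v) : u ≠ v := by
  rintro rfl
  exact G.not_adj_self _ h

theorem Into.adj {G : LMG V} {u v : V} (h : G.Into u v) : G.Adj u v :=
  adj_iff.2 (h.elim (fun h => .inr (.inr (.inl h))) (fun h => .inr (.inl h)))

theorem isAncestor_of_dir {G : LMG V} {u v : V} (h : G.dir u v) : G.IsAncestor u v :=
  Relation.TransGen.single h

theorem IsAncestor.trans {G : LMG V} {u v w : V} (h : G.IsAncestor u v) (h' : G.IsAncestor v w) :
    G.IsAncestor u w :=
  Relation.TransGen.trans h h'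

theorem isCollider_iff {G : LMG V} {i j k : V} :
    G.IsCollider i j k ↔ i ≠ k ∧ G.Into i j ∧ G.Into k j := Iff.rfl

theorem IsCollider.symm {G : LMG V} {i j k : V} (h : G.IsCollider i j k) : G.IsCollider k j i :=
  ⟨h.1.symm, h.2.2, h.2.1⟩

namespace IsAncestral

variable {G : LMG V} {a b c u v w : V}

theorem not_isAncestor_of_into (hG : G.IsAncestral) (h : G.Into u v) : ¬ G.IsAncestor v u := by
  intro h'
  rcases h with h | h
  · exact hG.no_directed_cycle u ((isAncestor_of_dir h).trans h')
  · exact (hG.bi_no_directed_path u v h).2 h'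

theorem not_into_of_isAncestor (hG : G.IsAncestral) (h : G.IsAncestor u v) : ¬ G.Into v u :=
  fun h' => hG.not_isAncestor_of_into h' h

theorem not_into_of_dir (hG : G.IsAncestral) (h : G.dir u v) : ¬ G.Into v u :=
  hG.not_into_of_isAncestor (isAncestor_of_dir h)

theorem not_und_of_into (hG : G.IsAncestral) (h : G.Into u v) : ¬ G.und v w := by
  intro h'
  obtain ⟨h1, h2, -⟩ := hG.und_no_arrowhead v w h' u
  exact h.elim h1 h2

theorem dir_of_not_into (hG : G.IsAncestral) (h : G.Into w u) (ha : G.Adj u v)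
    (hn : ¬ G.Into v u) : G.dir u v := by
  rcases adj_iff.1 ha with h1 | h1 | h1 | h1
  · exact (hG.not_und_of_into h h1).elim
  · exact (hn (.inr (G.bi_symm h1))).elim
  · exact h1
  · exact (hn (.inl h1)).elim

/-- An undirected edge is excluded by the arrowhead at `c`, and `c → a` would make `b` an ancestor
of `a`, against the arrowhead at `b`. -/
theorem into_of_into_of_dir (hG : G.IsAncestral) (hab : G.Into a b) (hbc : G.dir b c)
    (ha : G.Adj a c) : G.Into a c := by
  rcases adj_iff.1 ha with h | h | h | h
  · exact (hG.not_und_of_into (.inl hbc) (G.und_symm h)).elim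
  · exact .inr h
  · exact .inl h
  · exact (hG.not_isAncestor_of_into hab ((isAncestor_of_dir hbc).trans (isAncestor_of_dir h))).elim

theorem bi_of_into_of_into (hG : G.IsAncestral) (h : G.Into u v) (h' : G.Into v u) : G.bi u v := by
  rcases h with h | h
  · exact (hG.not_into_of_dir h h').elim
  · exact h

theorem isSimple (hG : G.IsAncestral) : G.IsSimple := by
  have key : ∀ u v, (G.und u v → ¬ G.Into u v) ∧ (G.und u v → ¬ G.Into v u) ∧
      (G.dir u v → ¬ G.Into v u) := fun u v =>
    ⟨fun h h' => hG.not_und_of_into h' (G.und_symm h), fun h h' => hG.not_und_of_into h' h,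
      fun h h' => hG.not_into_of_dir h h'⟩
  intro u v κ κ' h h'
  have h1 := key u v
  have h2 := key v u
  have h3 := @G.bi_symm u v
  cases κ <;> cases κ' <;> simp only [HasEdge, Into] at * <;> tauto

end IsAncestral

/-! ### Node descriptions of paths in simple graphs -/

theorem IsSimple.arrowAtEnd_iff {G : LMG V} (hG : G.IsSimple) {κ : EdgeKind} {u v : V}
    (h : G.HasEdge κ u v) : κ.ArrowAtEnd ↔ G.Into u v := by
  constructor
  · intro h'
    cases κ <;> simp_all [EdgeKind.ArrowAtEnd, HasEdge, Into]
  · rintro (h' | h')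
    · rw [hG h (κ' := .fwd) h']; trivial
    · rw [hG h (κ' := .arc) h']; trivial

theorem IsSimple.arrowAtStart_iff {G : LMG V} (hG : G.IsSimple) {κ : EdgeKind} {u v : V}
    (h : G.HasEdge κ u v) : κ.ArrowAtStart ↔ G.Into v u := by
  constructor
  · intro h'
    cases κ
    · exact h'.elim
    · exact .inr (G.bi_symm h)
    · exact h'.elim
    · exact .inl h
  · rintro (h' | h')
    · rw [hG h (κ' := .bwd) h']; trivial
    · rw [hG h (κ' := .arc) (G.bi_symm h')]; trivial

/-- The nodes `v 0, …, v n` are distinct, and consecutive ones are adjacent. -/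
def IsNodePath (G : LMG V) (n : ℕ) (v : ℕ → V) : Prop :=
  (∀ k < n, G.Adj (v k) (v (k + 1))) ∧ ∀ k ≤ n, ∀ l ≤ n, v k = v l → k = l

theorem exists_isPath_iff {G : LMG V} {n : ℕ} {v : ℕ → V} :
    (∃ e, G.IsPath n v e) ↔ G.IsNodePath n v := by
  constructor
  · rintro ⟨e, h1, h2⟩
    exact ⟨fun k hk => ⟨e k, h1 k hk⟩, h2⟩
  · rintro ⟨h1, h2⟩
    have : ∀ k, ∃ κ, k < n → G.HasEdge κ (v k) (v (k + 1)) := by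
      intro k
      by_cases hk : k < n
      · obtain ⟨κ, h⟩ := h1 k hk
        exact ⟨κ, fun _ => h⟩
      · exact ⟨.line, fun h => (hk h).elim⟩
    choose e he using this
    exact ⟨e, he, h2⟩

theorem IsSimple.colliderAt_iff {G : LMG V} (hG : G.IsSimple) {n : ℕ} {v : ℕ → V}
    {e : ℕ → EdgeKind} (h : G.IsPath n v e) {k : ℕ} (hk : k + 1 < n) :
    ColliderAt e k ↔ G.IsCollider (v k) (v (k + 1)) (v (k + 2)) := by
  rw [ColliderAt, hG.arrowAtEnd_iff (h.1 k (by omega)), hG.arrowAtStart_iff (h.1 (k + 1) hk)]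
  refine ⟨fun h' => ⟨fun he => ?_, h'⟩, fun h' => h'.2⟩
  have := h.2 k (by omega) (k + 2) (by omega) he
  omega

/-- The path with the given nodes is m-connecting given `C`. -/
def NodeConnecting (G : LMG V) (C : Set V) (n : ℕ) (v : ℕ → V) : Prop :=
  G.IsNodePath n v ∧
    (∀ k, k + 1 < n → G.IsCollider (v k) (v (k + 1)) (v (k + 2)) →
      v (k + 1) ∈ C ∪ G.ancestors C) ∧
    (∀ k, k + 1 < n → ¬ G.IsCollider (v k) (v (k + 1)) (v (k + 2)) → v (k + 1) ∉ C) ∧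
    v 0 ∉ C ∧ v n ∉ C

theorem IsSimple.exists_mConnecting_iff {G : LMG V} (hG : G.IsSimple) {C : Set V} {n : ℕ}
    {v : ℕ → V} : (∃ e, G.MConnecting C n v e) ↔ G.NodeConnecting C n v := by
  constructor
  · rintro ⟨e, h1, h2, h3, h4⟩
    exact ⟨exists_isPath_iff.1 ⟨e, h1⟩,
      fun k hk h => h2 k hk ((hG.colliderAt_iff h1 hk).2 h),
      fun k hk h => h3 k hk (fun h' => h ((hG.colliderAt_iff h1 hk).1 h')), h4⟩
  · rintro ⟨h1, h2, h3, h4⟩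
    obtain ⟨e, h1⟩ := exists_isPath_iff.2 h1
    exact ⟨e, h1, fun k hk h => h2 k hk ((hG.colliderAt_iff h1 hk).1 h),
      fun k hk h => h3 k hk (mt (hG.colliderAt_iff h1 hk).2 h), h4⟩

/-- The path with the given nodes is discriminating for `v (m + 1)`. -/
def NodeDiscriminating (G : LMG V) (m : ℕ) (v : ℕ → V) : Prop :=
  G.IsNodePath (m + 2) v ∧ ¬ G.Adj (v 0) (v (m + 2)) ∧
    ∀ k < m, G.IsCollider (v k) (v (k + 1)) (v (k + 2)) ∧ G.dir (v (k + 1)) (v (m + 2))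

theorem IsSimple.exists_isDiscriminatingPath_iff {G : LMG V} (hG : G.IsSimple) {m : ℕ}
    {v : ℕ → V} : (∃ e, G.IsDiscriminatingPath m v e) ↔ G.NodeDiscriminating m v := by
  constructor
  · rintro ⟨e, h1, h2, h3⟩
    exact ⟨exists_isPath_iff.1 ⟨e, h1⟩, h2, fun k hk =>
      ⟨(hG.colliderAt_iff h1 (by omega)).1 (h3 k hk).1, (h3 k hk).2⟩⟩
  · rintro ⟨h1, h2, h3⟩
    obtain ⟨e, h1⟩ := exists_isPath_iff.2 h1
    exact ⟨e, h1, h2, fun k hk =>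
      ⟨(hG.colliderAt_iff h1 (by omega)).2 (h3 k hk).1, (h3 k hk).2⟩⟩

/-- The path with the given nodes is an inducing path. -/
def NodeInducing (G : LMG V) (n : ℕ) (v : ℕ → V) : Prop :=
  G.IsNodePath n v ∧ ∀ k, k + 1 < n → G.IsCollider (v k) (v (k + 1)) (v (k + 2)) ∧
    (G.IsAncestor (v (k + 1)) (v 0) ∨ G.IsAncestor (v (k + 1)) (v n))

theorem IsSimple.exists_isInducingPath_iff {G : LMG V} (hG : G.IsSimple) {n : ℕ} {v : ℕ → V} :
    (∃ e, G.IsInducingPath n v e) ↔ G.NodeInducing n v := by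
  constructor
  · rintro ⟨e, h1, h2⟩
    exact ⟨exists_isPath_iff.1 ⟨e, h1⟩, fun k hk =>
      ⟨(hG.colliderAt_iff h1 hk).1 (h2 k hk).1, (h2 k hk).2⟩⟩
  · rintro ⟨h1, h2⟩
    obtain ⟨e, h1⟩ := exists_isPath_iff.2 h1
    exact ⟨e, h1, fun k hk => ⟨(hG.colliderAt_iff h1 hk).2 (h2 k hk).1, (h2 k hk).2⟩⟩

theorem IsNodePath.reverse {G : LMG V} {n : ℕ} {v : ℕ → V} (h : G.IsNodePath n v) :
    G.IsNodePath n (fun k => v (n - k)) := by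
  refine ⟨fun k hk => ?_, fun k hk l hl he => ?_⟩
  · have := (h.1 (n - (k + 1)) (by omega)).symm
    rwa [show n - (k + 1) + 1 = n - k by omega] at this
  · have := h.2 _ (by omega) _ (by omega) he
    omega

theorem NodeInducing.reverse {G : LMG V} {n : ℕ} {v : ℕ → V} (h : G.NodeInducing n v) :
    G.NodeInducing n (fun k => v (n - k)) := by
  refine ⟨h.1.reverse, fun k hk => ?_⟩
  obtain ⟨h1, h2⟩ := h.2 (n - (k + 2)) (by omega)
  rw [show n - (k + 2) + 1 = n - (k + 1) by omega, show n - (k + 2) + 2 = n - k by omega] at h1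
  rw [show n - (k + 2) + 1 = n - (k + 1) by omega] at h2
  exact ⟨h1.symm, by simpa using h2.symm⟩

theorem IsSimple.inducingConnected_iff {G : LMG V} (hG : G.IsSimple) {i j : V} :
    G.InducingConnected i j ↔ ∃ n v, G.NodeInducing n v ∧ v 0 = i ∧ v n = j := by
  constructor
  · rintro ⟨n, v, e, h, ⟨h0, hn⟩ | ⟨h0, hn⟩⟩
    · exact ⟨n, v, hG.exists_isInducingPath_iff.1 ⟨e, h⟩, h0, hn⟩
    · exact ⟨n, _, (hG.exists_isInducingPath_iff.1 ⟨e, h⟩).reverse, by simpa using hn,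
        by simpa using h0⟩
  · rintro ⟨n, v, h, h0, hn⟩
    obtain ⟨e, h⟩ := hG.exists_isInducingPath_iff.2 h
    exact ⟨n, v, e, h, .inl ⟨h0, hn⟩⟩

/-- Two nodes are joined by an m-connecting path. -/
def MConnected (G : LMG V) (C : Set V) (x y : V) : Prop :=
  ∃ n v e, v 0 = x ∧ v n = y ∧ G.MConnecting C n v e

theorem IsSimple.mConnected_iff {G : LMG V} (hG : G.IsSimple) {C : Set V} {x y : V} :
    G.MConnected C x y ↔ ∃ n v, v 0 = x ∧ v n = y ∧ G.NodeConnecting C n v := by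
  constructor
  · rintro ⟨n, v, e, h0, hn, h⟩
    exact ⟨n, v, h0, hn, hG.exists_mConnecting_iff.1 ⟨e, h⟩⟩
  · rintro ⟨n, v, h0, hn, h⟩
    obtain ⟨e, h⟩ := hG.exists_mConnecting_iff.2 h
    exact ⟨n, v, e, h0, hn, h⟩

theorem mem_indepModel_iff {G : LMG V} {A B C : Set V} :
    (A, B, C) ∈ G.indepModel ↔
      Disjoint A B ∧ ∀ x ∈ A, ∀ y ∈ B, ¬ G.MConnected C x y := by
  refine and_congr_right fun _ => ⟨?_, ?_⟩
  · rintro h x hx y hy ⟨n, v, e, rfl, rfl, hc⟩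
    exact h n v e hx hy hc
  · intro h n v e hx hy hc
    exact h _ hx _ hy ⟨n, v, e, rfl, rfl, hc⟩

/-- Markov equivalence only concerns pairs of distinct nodes. -/
theorem markovEquiv_iff {G H : LMG V} :
    G.MarkovEquiv H ↔
      ∀ C x y, x ≠ y → (G.MConnected C x y ↔ H.MConnected C x y) := by
  constructor
  · intro h C x y hxy
    have h1 : (({x}, {y}, C) : Set V × Set V × Set V) ∈ G.indepModel ↔
        ({x}, {y}, C) ∈ H.indepModel := by
      rw [show G.indepModel = H.indepModel from h]
    simpa [mem_indepModel_iff, hxy, not_iff_not] using h1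
  · intro h
    refine Set.ext ?_
    rintro ⟨A, B, C⟩
    rw [mem_indepModel_iff, mem_indepModel_iff]
    refine and_congr_right fun hd => forall₂_congr fun x hx => forall₂_congr fun y hy => ?_
    rw [h C x y (hd.ne_of_mem hx hy)]

theorem NodeConnecting.of_adj {G : LMG V} {C : Set V} {x y : V} (h : G.Adj x y)
    (hx : x ∉ C) (hy : y ∉ C) : G.NodeConnecting C 1 (fun k => if k = 0 then x else y) := by
  refine ⟨⟨?_, ?_⟩, fun k hk => by omega, fun k hk => by omega, by simpa, by simpa⟩
  · intro k hk
    obtain rfl : k = 0 := by omega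
    simpa using h
  · intro k hk l hl
    have := h.ne
    interval_cases k <;> interval_cases l <;> simp_all [eq_comm]

end LMG

namespace LMG

variable {V : Type*}

/-! ### Connecting walks -/

/-- There is a directed walk with `k` edges from `u` to a member of `C`. -/
def DirDist (G : LMG V) (C : Set V) : ℕ → V → Prop
  | 0, u => u ∈ C
  | k + 1, u => ∃ w, G.dir u w ∧ G.DirDist C k w

theorem DirDist.mem {G : LMG V} {C : Set V} {k : ℕ} {u : V} (h : G.DirDist C k u) :
    u ∈ C ∪ G.ancestors C := by
  induction k generalizing u with
  | zero => exact .inl h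
  | succ k ih =>
    obtain ⟨w, hw, h⟩ := h
    rcases ih h with h | ⟨z, hz, h⟩
    · exact .inr ⟨w, h, isAncestor_of_dir hw⟩
    · exact .inr ⟨z, hz, (isAncestor_of_dir hw).trans h⟩

theorem exists_dirDist_of_isAncestor {G : LMG V} {C : Set V} {u w : V} (h : G.IsAncestor u w)
    (hw : ∃ k, G.DirDist C k w) : ∃ k, G.DirDist C k u := by
  induction h using Relation.TransGen.head_induction_on with
  | single h =>
    obtain ⟨k, hw⟩ := hw
    exact ⟨k + 1, _, h, hw⟩
  | head h _ ih =>
    obtain ⟨k, hw⟩ := ih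
    exact ⟨k + 1, _, h, hw⟩

theorem exists_dirDist_iff {G : LMG V} {C : Set V} {u : V} :
    (∃ k, G.DirDist C k u) ↔ u ∈ C ∪ G.ancestors C := by
  refine ⟨fun ⟨k, h⟩ => h.mem, ?_⟩
  rintro (h | ⟨z, hz, h⟩)
  · exact ⟨0, h⟩
  · exact exists_dirDist_of_isAncestor h ⟨0, hz⟩

/-- A walk may pass through `u` given `C`, where `a` and `b` say whether its two edges at `u` have
an arrowhead there. The weight `k` is the length of a directed walk from a collider to `C`. -/
def Pass (G : LMG V) (C : Set V) (u : V) (a b : Prop) (k : ℕ) : Prop :=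
  (a ∧ b ∧ G.DirDist C k u) ∨ (¬ (a ∧ b) ∧ u ∉ C ∧ k = 0)

theorem Pass.symm {G : LMG V} {C : Set V} {u : V} {a b : Prop} {k : ℕ} (h : G.Pass C u a b k) :
    G.Pass C u b a k := by
  unfold Pass at *
  tauto

theorem Pass.dirDist {G : LMG V} {C : Set V} {u : V} {a b : Prop} {k : ℕ} (h : G.Pass C u a b k)
    (ha : a) (hb : b) : G.DirDist C k u := by
  unfold Pass at h
  tauto

theorem Pass.notMem {G : LMG V} {C : Set V} {u : V} {a b : Prop} {k : ℕ} (h : G.Pass C u a b k)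
    (hn : ¬ (a ∧ b)) : u ∉ C := by
  unfold Pass at h
  tauto

/-- A walk from `x` to `u` with `n` edges whose nodes before `u` may be passed given `C` and have
total weight `s`; `a` says whether its last edge has an arrowhead at `u`. -/
inductive Trail (G : LMG V) (C : Set V) (x : V) : ℕ → ℕ → V → Prop → Prop
  | nil : Trail G C x 0 0 x False
  | step {n s u a w k} : Trail G C x n s u a → G.Adj u w → G.Pass C u a (G.Into w u) k →
      Trail G C x (n + 1) (s + k) w (G.Into u w)

/-- The edge before `v k` has an arrowhead at `v k`. -/
def InHead (G : LMG V) (v : ℕ → V) (k : ℕ) : Prop := 0 < k ∧ G.Into (v (k - 1)) (v k)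

/-- The edge after `v k` has an arrowhead at `v k`. -/
def OutHead (G : LMG V) (n : ℕ) (v : ℕ → V) (k : ℕ) : Prop := k < n ∧ G.Into (v (k + 1)) (v k)

/-- A walk with `n` edges that is m-connecting given `C`, with the weights of its nodes. -/
structure ConnWalk (G : LMG V) (C : Set V) (n : ℕ) (v : ℕ → V) (w : ℕ → ℕ) : Prop where
  adj : ∀ k < n, G.Adj (v k) (v (k + 1))
  pass : ∀ k ≤ n, G.Pass C (v k) (G.InHead v k) (G.OutHead n v k) (w k)

/-! ### Reversal and concatenation of connecting walks -/

theorem inHead_reverse {G : LMG V} {n k : ℕ} {v : ℕ → V} (hk : k ≤ n) :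
    G.InHead (fun k => v (n - k)) k = G.OutHead n v (n - k) := by
  refine propext (and_congr_right_iff.2 ?_ |>.trans (and_congr_left_iff.2 ?_))
  · exact fun hk => by simp only [show n - (k - 1) = n - k + 1 by omega]
  · intro _; omega

theorem outHead_reverse {G : LMG V} {n k : ℕ} {v : ℕ → V} (hk : k ≤ n) :
    G.OutHead n (fun k => v (n - k)) k = G.InHead v (n - k) := by
  refine propext (and_congr_right_iff.2 ?_ |>.trans (and_congr_left_iff.2 ?_))
  · exact fun hk => by simp only [show n - (k + 1) = n - k - 1 by omega]
  · intro _; omega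

theorem ConnWalk.reverse {G : LMG V} {C : Set V} {n : ℕ} {v : ℕ → V} {w : ℕ → ℕ}
    (h : G.ConnWalk C n v w) : G.ConnWalk C n (fun k => v (n - k)) (fun k => w (n - k)) := by
  refine ⟨fun k hk => ?_, fun k hk => ?_⟩
  · have := (h.adj (n - (k + 1)) (by omega)).symm
    rwa [show n - (k + 1) + 1 = n - k by omega] at this
  · rw [inHead_reverse hk, outHead_reverse hk]
    exact (h.pass (n - k) (by omega)).symm

theorem ConnWalk.trail {G : LMG V} {C : Set V} {n : ℕ} {v : ℕ → V} {w : ℕ → ℕ}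
    (h : G.ConnWalk C n v w) {k : ℕ} (hk : k ≤ n) :
    G.Trail C (v 0) k (∑ i ∈ Finset.range k, w i) (v k) (G.InHead v k) := by
  induction k with
  | zero =>
    have : G.InHead v 0 = False := by simp [InHead]
    rw [this]
    exact .nil
  | succ k ih =>
    have h1 := h.pass k (by omega)
    have e1 : G.OutHead n v k = G.Into (v (k + 1)) (v k) := by simp [OutHead, show k < n by omega]
    have e2 : G.InHead v (k + 1) = G.Into (v k) (v (k + 1)) := by simp [InHead]
    rw [e1] at h1
    rw [Finset.sum_range_succ, e2]
    exact .step (ih (by omega)) (h.adj k (by omega)) h1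

theorem ConnWalk.trail_reverse {G : LMG V} {C : Set V} {n : ℕ} {v : ℕ → V} {w : ℕ → ℕ}
    (h : G.ConnWalk C n v w) {k : ℕ} (hk : k ≤ n) :
    G.Trail C (v n) (n - k) (∑ i ∈ Finset.range (n - k), w (n - i)) (v k) (G.OutHead n v k) := by
  have := h.reverse.trail (k := n - k) (by omega)
  rw [inHead_reverse (by omega)] at this
  simpa only [show n - (n - k) = k by omega, Nat.sub_zero] using this

/-- Induction on the second trail: its last edge is taken off and appended, reversed, to the first
one. Since passing is symmetric in the two arrowhead conditions, the total weight is preserved. -/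
theorem Trail.join_aux {G : LMG V} {C : Set V} {x y u : V} {p q s t k : ℕ} {a b : Prop}
    (h1 : G.Trail C x p s u a) (h2 : G.Trail C y q t u b) (h : G.Pass C u a b k) :
    ∃ s' k' a', G.Trail C x (p + q) s' y a' ∧ G.Pass C y a' False k' ∧ s' + k' = s + k + t := by
  induction h2 generalizing p s a k with
  | nil => exact ⟨s, k, a, h1, h, rfl⟩
  | @step n t w b u l h2 hadj hp ih =>
    obtain ⟨s', k', a', h3, h4, h5⟩ := ih (.step h1 hadj.symm h) hp.symm
    refine ⟨s', k', a', ?_, h4, by omega⟩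
    rwa [show p + (n + 1) = p + 1 + n by omega]

theorem Trail.exists_walk {G : LMG V} {C : Set V} {x u : V} {n s : ℕ} {a : Prop}
    (h : G.Trail C x n s u a) : ∃ (v : ℕ → V) (w : ℕ → ℕ), v 0 = x ∧ v n = u ∧
      a = G.InHead v n ∧ (∀ k < n, G.Adj (v k) (v (k + 1))) ∧
      (∀ k < n, G.Pass C (v k) (G.InHead v k) (G.OutHead n v k) (w k)) ∧
      ∑ i ∈ Finset.range n, w i = s := by
  induction h with
  | nil => exact ⟨fun _ => x, fun _ => 0, rfl, rfl, by simp [InHead], by simp, by simp, by simp⟩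
  | @step n s u a z l h hadj hp ih =>
    obtain ⟨v, w, h0, hn, ha, h1, h2, h3⟩ := ih
    have hv : ∀ k ≤ n, Function.update v (n + 1) z k = v k := fun k hk => by
      rw [Function.update_of_ne (by omega)]
    have hw : ∀ k < n, Function.update w n l k = w k := fun k hk => by
      rw [Function.update_of_ne (by omega)]
    have hin : ∀ k ≤ n, G.InHead (Function.update v (n + 1) z) k = G.InHead v k := fun k hk => by
      rw [InHead, InHead, hv k hk, hv (k - 1) (by omega)]
    refine ⟨Function.update v (n + 1) z, Function.update w n l, ?_, ?_, ?_, ?_, ?_, ?_⟩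
    · rw [hv 0 (by omega), h0]
    · simp
    · simp [InHead, hn]
    · intro k hk
      rw [hv k (by omega)]
      rcases Nat.lt_succ_iff_lt_or_eq.1 hk with hk | rfl
      · rw [hv _ (by omega)]
        exact h1 k hk
      · simpa [hn] using hadj
    · intro k hk
      rw [hv k (by omega), hin k (by omega)]
      rcases Nat.lt_succ_iff_lt_or_eq.1 hk with hk | rfl
      · have := h2 k hk
        rw [hw k hk, OutHead, hv k (by omega), hv (k + 1) (by omega)]
        simpa [OutHead, hk, show k < n + 1 by omega] using this
      · have e : G.OutHead (k + 1) (Function.update v (k + 1) z) k = G.Into z u := by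
          simp [OutHead, hn]
        rw [e, hn, ← ha]
        simpa using hp
    · rw [Finset.sum_range_succ]
      simp only [Function.update_self]
      rw [Finset.sum_congr rfl fun i hi => hw i (Finset.mem_range.1 hi), h3]

/-- Two walks that meet in a node that may be passed form a connecting walk. -/
theorem Trail.join {G : LMG V} {C : Set V} {x y u : V} {p q s t k : ℕ} {a b : Prop}
    (h1 : G.Trail C x p s u a) (h2 : G.Trail C y q t u b) (h : G.Pass C u a b k) :
    ∃ v w, v 0 = x ∧ v (p + q) = y ∧ G.ConnWalk C (p + q) v w ∧
      ∑ i ∈ Finset.range (p + q + 1), w i = s + k + t := by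
  obtain ⟨s', k', a', h3, h4, h5⟩ := h1.join_aux h2 h
  obtain ⟨v, w, h0, hn, rfl, hv, hp, hs⟩ := h3.exists_walk
  have hw : ∀ i < p + q, Function.update w (p + q) k' i = w i := fun i hi => by
    rw [Function.update_of_ne (by omega)]
  refine ⟨v, Function.update w (p + q) k', h0, hn, ⟨hv, fun i hi => ?_⟩, ?_⟩
  · rcases hi.lt_or_eq with hi | rfl
    · rw [hw i hi]
      exact hp i hi
    · rw [show G.OutHead (p + q) v (p + q) = False by simp [OutHead], hn]
      simpa using h4
  · rw [Finset.sum_range_succ, Finset.sum_congr rfl fun i hi => hw i (Finset.mem_range.1 hi), hs]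
    simpa using h5

/-- A connecting walk between its endpoints that has the fewest edges, and among these walks the
least total weight. -/
structure MinWalk (G : LMG V) (C : Set V) (n : ℕ) (v : ℕ → V) (w : ℕ → ℕ) : Prop extends
    G.ConnWalk C n v w where
  ne : v 0 ≠ v n
  min : ∀ ⦃p q s t u a b k⦄, G.Trail C (v 0) p s u a → G.Trail C (v n) q t u b →
    G.Pass C u a b k → n ≤ p + q ∧ (p + q = n → ∑ i ∈ Finset.range (n + 1), w i ≤ s + k + t)

/-- Two nested minimizations: first over the number of edges, then over the total weight at that
length. -/
theorem exists_minWalk {G : LMG V} {C : Set V} {n : ℕ} {v : ℕ → V} {w : ℕ → ℕ}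
    (h : G.ConnWalk C n v w) (hne : v 0 ≠ v n) :
    ∃ n' v' w', G.MinWalk C n' v' w' ∧ v' 0 = v 0 ∧ v' n' = v n := by
  classical
  have hex : ∃ m, ∃ v' w', v' 0 = v 0 ∧ v' m = v n ∧ G.ConnWalk C m v' w' := ⟨n, v, w, rfl, rfl, h⟩
  set m := Nat.find hex with hm
  have hex' : ∃ s, ∃ v' w', v' 0 = v 0 ∧ v' m = v n ∧ G.ConnWalk C m v' w' ∧
      ∑ i ∈ Finset.range (m + 1), w' i = s := by
    obtain ⟨v', w', h0, hn, h'⟩ := Nat.find_spec hex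
    exact ⟨_, v', w', h0, hn, h', rfl⟩
  obtain ⟨v', w', h0, hn, h', hs⟩ := Nat.find_spec hex'
  refine ⟨m, v', w', ⟨h', by rwa [h0, hn], ?_⟩, h0, hn⟩
  intro p q s t u a b k h1 h2 hp
  rw [h0] at h1
  rw [hn] at h2
  obtain ⟨v₁, w₁, g0, gn, g, gs⟩ := h1.join h2 hp
  refine ⟨Nat.find_min' hex ⟨v₁, w₁, g0, gn, g⟩, fun e => ?_⟩
  rw [hs]
  exact Nat.find_min' hex' ⟨v₁, w₁, g0, by rw [← e, gn], by rwa [← e], by rw [← e, gs]⟩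

theorem MinWalk.reverse {G : LMG V} {C : Set V} {n : ℕ} {v : ℕ → V} {w : ℕ → ℕ}
    (h : G.MinWalk C n v w) : G.MinWalk C n (fun k => v (n - k)) (fun k => w (n - k)) := by
  refine ⟨h.toConnWalk.reverse, by simpa using h.ne.symm, ?_⟩
  intro p q s t u a b k h1 h2 hp
  have := h.min (by simpa using h2) (by simpa using h1) hp.symm
  refine ⟨by omega, fun e => ?_⟩
  have h3 := Finset.sum_range_reflect w (n + 1)
  simp only [Nat.add_sub_cancel] at h3
  rw [h3]
  have := this.2 (by omega)
  omega

/-- A walk that leaves `v k` by a directed edge stays directed up to its next collider. -/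
theorem IsAncestral.isAncestor_or_collider {G : LMG V} (hG : G.IsAncestral) {n k m : ℕ}
    {v : ℕ → V} (hadj : ∀ l < n, G.Adj (v l) (v (l + 1))) (hk : G.dir (v k) (v (k + 1)))
    (hkm : k < m) (hm : m ≤ n) :
    (G.IsAncestor (v k) (v m) ∧ G.Into (v (m - 1)) (v m)) ∨
      ∃ l, k < l ∧ l < m ∧ G.IsAncestor (v k) (v l) ∧ G.Into (v (l - 1)) (v l) ∧
        G.Into (v (l + 1)) (v l) := by
  induction m with
  | zero => omega
  | succ m ih =>
    rcases Nat.lt_succ_iff_lt_or_eq.1 hkm with h | rfl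
    · rcases ih h (by omega) with ⟨h1, h2⟩ | ⟨l, h1, h2, h3⟩
      · by_cases h3 : G.Into (v (m + 1)) (v m)
        · exact .inr ⟨m, h, by omega, h1, h2, h3⟩
        · have h4 := hG.dir_of_not_into h2 (hadj m (by omega)) h3
          exact .inl ⟨h1.trans (isAncestor_of_dir h4), .inl h4⟩
      · exact .inr ⟨l, h1, by omega, h3⟩
    · exact .inl ⟨isAncestor_of_dir hk, .inl hk⟩

/-- A closed piece between two visits of a node could be cut out. The only doubtful case is that the
node becomes a collider without having been one at its first visit. Then the walk leaves it there by
a directed edge, and as there are no directed cycles, it meets inside the closed piece a collider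
that is a descendant. That collider leads to `C`, so the node does too. -/
theorem MinWalk.isNodePath {G : LMG V} (hG : G.IsAncestral) {C : Set V} {n : ℕ} {v : ℕ → V}
    {w : ℕ → ℕ} (h : G.MinWalk C n v w) : G.IsNodePath n v := by
  refine ⟨h.adj, ?_⟩
  have key : ∀ i j, i < j → j ≤ n → v i ≠ v j := by
    intro i j hij hj he
    have h1 := h.toConnWalk.trail (k := i) (by omega)
    have h2 := h.toConnWalk.trail_reverse hj
    have hi := h.pass i (by omega)
    have hj' := h.pass j hj
    rw [← he] at h2 hj'
    have : ∃ k, G.Pass C (v i) (G.InHead v i) (G.OutHead n v j) k := by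
      by_cases ha : G.InHead v i
      · by_cases hb : G.OutHead n v j
        · have : ∃ k, G.DirDist C k (v i) := by
            by_cases hc : G.OutHead n v i
            · exact ⟨_, hi.dirDist ha hc⟩
            · have hd : G.dir (v i) (v (i + 1)) :=
                hG.dir_of_not_into ha.2 (h.adj i (by omega)) (fun h' => hc ⟨by omega, h'⟩)
              rcases hG.isAncestor_or_collider h.adj hd hij hj with ⟨h3, -⟩ | ⟨l, h3, h4, h5, h6⟩
              · rw [← he] at h3
                exact (hG.no_directed_cycle _ h3).elim
              · exact exists_dirDist_of_isAncestor h5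
                  ⟨_, (h.pass l (by omega)).dirDist ⟨by omega, h6.1⟩ ⟨by omega, h6.2⟩⟩
          obtain ⟨k, hk⟩ := this
          exact ⟨k, .inl ⟨ha, hb, hk⟩⟩
        · exact ⟨0, .inr ⟨fun h' => hb h'.2, hj'.notMem (fun h' => hb h'.2), rfl⟩⟩
      · exact ⟨0, .inr ⟨fun h' => ha h'.1, hi.notMem (fun h' => ha h'.1), rfl⟩⟩
    obtain ⟨k, hk⟩ := this
    have := (h.min h1 h2 hk).1
    omega
  intro k hk l hl he
  rcases lt_trichotomy k l with h' | h' | h'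
  · exact (key k l h' hl he).elim
  · exact h'
  · exact (key l k h' hk he.symm).elim

theorem NodeConnecting.exists_connWalk {G : LMG V} {C : Set V} {n : ℕ} {v : ℕ → V}
    (h : G.NodeConnecting C n v) : ∃ w, G.ConnWalk C n v w := by
  obtain ⟨⟨h1, hinj⟩, h2, h3, h4, h5⟩ := h
  have : ∀ k, ∃ w, k ≤ n → G.Pass C (v k) (G.InHead v k) (G.OutHead n v k) w := by
    intro k
    by_cases hk0 : k = 0
    · subst hk0
      exact ⟨0, fun _ => .inr ⟨fun h => absurd h.1.1 (by omega), h4, rfl⟩⟩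
    by_cases hkn : k < n
    · obtain ⟨k, rfl⟩ := Nat.exists_eq_succ_of_ne_zero hk0
      by_cases hc : G.IsCollider (v k) (v (k + 1)) (v (k + 2))
      · obtain ⟨w, hw⟩ := exists_dirDist_iff.2 (h2 k hkn hc)
        exact ⟨w, fun _ => .inl ⟨⟨by omega, hc.2.1⟩, ⟨hkn, hc.2.2⟩, hw⟩⟩
      · refine ⟨0, fun _ => .inr ⟨fun h => hc ⟨fun he => ?_, h.1.2, h.2.2⟩, h3 k hkn hc, rfl⟩⟩
        have := hinj k (by omega) (k + 2) (by omega) he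
        omega
    · refine ⟨0, fun hk => .inr ⟨fun h => hkn h.2.1, ?_, rfl⟩⟩
      rwa [show k = n by omega]
  choose w hw using this
  exact ⟨w, h1, hw⟩

theorem ConnWalk.nodeConnecting {G : LMG V} {C : Set V} {n : ℕ} {v : ℕ → V} {w : ℕ → ℕ}
    (h : G.ConnWalk C n v w) (hp : G.IsNodePath n v) : G.NodeConnecting C n v := by
  refine ⟨hp, fun k hk hc => ?_, fun k hk hc => ?_, ?_, ?_⟩
  · exact ((h.pass (k + 1) hk.le).dirDist ⟨by omega, hc.2.1⟩ ⟨hk, hc.2.2⟩).mem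
  · refine (h.pass (k + 1) hk.le).notMem fun h' => hc ⟨fun he => ?_, h'.1.2, h'.2.2⟩
    have := hp.2 k (by omega) (k + 2) (by omega) he
    omega
  · exact (h.pass 0 (by omega)).notMem fun h' => absurd h'.1.1 (by omega)
  · exact (h.pass n le_rfl).notMem fun h' => absurd h'.2.1 (by omega)

/-- In an ancestral graph, m-connection by paths and by walks agree. -/
theorem IsAncestral.mConnected_iff_exists_connWalk {G : LMG V} (hG : G.IsAncestral) {C : Set V}
    {x y : V} (hne : x ≠ y) :
    G.MConnected C x y ↔ ∃ n v w, v 0 = x ∧ v n = y ∧ G.ConnWalk C n v w := by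
  rw [hG.isSimple.mConnected_iff]
  constructor
  · rintro ⟨n, v, h0, hn, h⟩
    obtain ⟨w, hw⟩ := h.exists_connWalk
    exact ⟨n, v, w, h0, hn, hw⟩
  · rintro ⟨n, v, w, rfl, rfl, h⟩
    obtain ⟨n', v', w', h', h0, hn⟩ := exists_minWalk h hne
    exact ⟨n', v', h0, hn, h'.toConnWalk.nodeConnecting (h'.isNodePath hG)⟩

/-- In an ancestral graph, m-connection in terms of trails. -/
theorem IsAncestral.mConnected_iff_exists_trail {G : LMG V} (hG : G.IsAncestral) {C : Set V}
    {x y : V} (hne : x ≠ y) :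
    G.MConnected C x y ↔ y ∉ C ∧ ∃ n s a, G.Trail C x n s y a := by
  rw [hG.mConnected_iff_exists_connWalk hne]
  constructor
  · rintro ⟨n, v, w, rfl, rfl, h⟩
    exact ⟨(h.pass n le_rfl).notMem fun h' => absurd h'.2.1 (by omega), _, _, _, h.trail le_rfl⟩
  · rintro ⟨hy, n, s, a, h⟩
    obtain ⟨v, w, h0, hn, hw, -⟩ := h.join .nil (.inr ⟨fun h => h.2, hy, rfl⟩)
    exact ⟨_, v, w, h0, hn, hw⟩

end LMG

namespace LMG

variable {V : Type*}

/-! ### Inducing paths and maximal extensions -/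

/-- Any two distinct nodes joined by an inducing path are adjacent. -/
def IsMaximal (G : LMG V) : Prop :=
  ∀ i j, i ≠ j → G.InducingConnected i j → G.Adj i j

theorem NodeInducing.two_le {G : LMG V} {n : ℕ} {v : ℕ → V} (h : G.NodeInducing n v)
    (hne : v 0 ≠ v n) (hadj : ¬ G.Adj (v 0) (v n)) : 2 ≤ n := by
  by_contra hn
  obtain rfl | rfl : n = 0 ∨ n = 1 := by omega
  · exact hne rfl
  · exact hadj (h.1.1 0 (by omega))

/-- Otherwise the last inner node would be an ancestor of `v n` in either case, although the edge
from `v n` has an arrowhead at it. -/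
theorem NodeInducing.not_isAncestor {G : LMG V} (hG : G.IsAncestral) {n : ℕ} {v : ℕ → V}
    (h : G.NodeInducing n v) (hn : 2 ≤ n) : ¬ G.IsAncestor (v 0) (v n) := by
  obtain ⟨n, rfl⟩ : ∃ k, n = k + 2 := ⟨n - 2, by omega⟩
  intro h0
  obtain ⟨h1, h2⟩ := h.2 n (by omega)
  exact hG.not_isAncestor_of_into h1.2.2 (h2.elim (fun h => h.trans h0) id)

theorem NodeInducing.bi_first {G : LMG V} (hG : G.IsAncestral) {n : ℕ} {v : ℕ → V}
    (h : G.NodeInducing n v) (hn : 2 ≤ n) : G.bi (v 0) (v 1) := by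
  obtain ⟨h1, h2⟩ := h.2 0 (by omega)
  rcases h1.2.1 with h3 | h3
  · have h4 := isAncestor_of_dir h3
    exact (h2.elim (fun h => hG.no_directed_cycle _ (h4.trans h))
      (fun h' => h.not_isAncestor hG hn (h4.trans h'))).elim
  · exact h3

theorem NodeInducing.bi {G : LMG V} (hG : G.IsAncestral) {n : ℕ} {v : ℕ → V}
    (h : G.NodeInducing n v) (hn : 2 ≤ n) {k : ℕ} (hk : k < n) : G.bi (v k) (v (k + 1)) := by
  rcases Nat.eq_zero_or_pos k with rfl | h0
  · exact h.bi_first hG hn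
  rcases (show k + 1 ≤ n by omega).lt_or_eq with h1 | rfl
  · obtain ⟨k, rfl⟩ := Nat.exists_eq_succ_of_ne_zero h0.ne'
    exact hG.bi_of_into_of_into (h.2 (k + 1) h1).1.2.1 (h.2 k (by omega)).1.2.2
  · have := h.reverse.bi_first hG hn
    exact G.bi_symm (by simpa using this)

theorem maximalExtension_dirDist {G : LMG V} {C : Set V} {k : ℕ} {u : V} :
    G.maximalExtension.DirDist C k u ↔ G.DirDist C k u := by
  induction k generalizing u with
  | zero => rfl
  | succ k ih => exact exists_congr fun w => and_congr Iff.rfl ih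

/-- The directed edges do not change. An inducing path between nonadjacent nodes consists of
bidirected edges only, so an added edge creates no arrowhead at a node that had none. -/
theorem maximalExtension_isAncestral {G : LMG V} (hG : G.IsAncestral) :
    G.maximalExtension.IsAncestral := by
  have key : ∀ i j, i ≠ j ∧ ¬ G.Adj i j ∧ G.InducingConnected i j →
      ¬ G.IsAncestor i j ∧ ¬ G.IsAncestor j i ∧ ∃ k, G.bi k j := by
    rintro i j ⟨h1, h2, h3⟩
    obtain ⟨n, v, h, rfl, rfl⟩ := hG.isSimple.inducingConnected_iff.1 h3
    have hn := h.two_le h1 h2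
    refine ⟨h.not_isAncestor hG hn, ?_, v (n - 1), ?_⟩
    · simpa using h.reverse.not_isAncestor hG hn
    · have := h.bi hG hn (k := n - 1) (by omega)
      rwa [show n - 1 + 1 = n by omega] at this
  refine ⟨hG.no_directed_cycle, ?_, ?_⟩
  · rintro i j (h | h)
    · exact hG.bi_no_directed_path i j h
    · exact ⟨(key i j h).1, (key i j h).2.1⟩
  · intro i j h k
    have hu := hG.und_no_arrowhead i j h
    refine ⟨(hu k).1, ?_, (hu k).2.2.1, ?_⟩
    · rintro (h' | h')
      · exact (hu k).2.1 h'
      · obtain ⟨l, hl⟩ := (key _ _ h').2.2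
        exact (hu l).2.1 hl
    · rintro (h' | h')
      · exact (hu k).2.2.2 h'
      · obtain ⟨l, hl⟩ := (key _ _ h').2.2
        exact (hu l).2.2.2 hl

theorem maximalExtension_adj_iff {G : LMG V} {u v : V} :
    G.maximalExtension.Adj u v ↔ G.Adj u v ∨ (u ≠ v ∧ G.InducingConnected u v) := by
  rw [adj_iff, adj_iff (G := G)]
  constructor
  · rintro (h | (h | h) | h)
    · exact .inl (.inl h)
    · exact .inl (.inr (.inl h))
    · exact .inr ⟨h.1, h.2.2⟩
    · exact .inl (.inr (.inr h))
  · by_cases ha : G.Adj u v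
    · intro _
      rcases adj_iff.1 ha with h | h | h
      · exact .inl h
      · exact .inr (.inl (.inl h))
      · exact .inr (.inr h)
    · rintro (h | h)
      · exact (ha (adj_iff.2 h)).elim
      · exact .inr (.inl (.inr ⟨h.1, ha, h.2⟩))

theorem maximalExtension_into_iff {G : LMG V} {u v : V} (h : G.Adj u v) :
    G.maximalExtension.Into u v ↔ G.Into u v := by
  refine or_congr_right ⟨?_, .inl⟩
  rintro (h' | h')
  exacts [h', (h'.2.1 h).elim]

/-- No node on the directed path from `q` to `u` before `u` lies in `C`, since `q` is neither in `C`
nor an ancestor of it, and none of them becomes a collider. So the trail may follow the path. -/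
theorem Trail.descend {G : LMG V} (hG : G.IsAncestral) {C : Set V} {x q u : V} {n s : ℕ}
    {a : Prop} (h : G.Trail C x n s q a) (hq : q ∉ C ∪ G.ancestors C) (hu : G.IsAncestor q u) :
    ∃ n s, ∃ a : Prop, a ∧ G.Trail C x n s u a := by
  have step : ∀ {p r : V} {n s : ℕ} {a : Prop}, G.Trail C x n s p a → p ∉ C → G.dir p r →
      ∃ n s, ∃ a : Prop, a ∧ G.Trail C x n s r a := fun {p r n s a} h hp hd =>
    ⟨_, _, _, .inl hd, .step h (adj_iff.2 (.inr (.inr (.inl hd))))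
      (.inr ⟨fun h' => hG.not_into_of_dir hd h'.2, hp, rfl⟩)⟩
  induction hu with
  | single hd => exact step h (fun h' => hq (.inl h')) hd
  | tail hqp hd ih =>
    obtain ⟨n, s, a, -, h'⟩ := ih
    exact step h' (fun h' => hq (.inr ⟨_, h', hqp⟩)) hd

/-- The directed path from `q` to `u` is traversed backwards. The trail reaches `q` without an
arrowhead there, so `q` can be passed next as a noncollider. -/
theorem Trail.ascend {G : LMG V} (hG : G.IsAncestral) {C : Set V} {x q u : V} {n s k : ℕ}
    {a : Prop} (h : G.Trail C x n s u a) (hp : G.Pass C u a True k)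
    (hq : q ∉ C ∪ G.ancestors C) (hu : G.IsAncestor q u) :
    ∃ n s, ∃ a : Prop, ¬ a ∧ G.Trail C x n s q a := by
  have step : ∀ {p r : V} {n s k : ℕ} {a : Prop}, G.Trail C x n s r a → G.Pass C r a True k →
      G.dir p r → ∃ n s, ∃ a : Prop, ¬ a ∧ G.Trail C x n s p a := fun {p r n s k a} h hp hd =>
    ⟨_, _, _, hG.not_into_of_dir hd, .step h (adj_iff.2 (.inr (.inr (.inr hd))))
      (by rwa [eq_true (show G.Into p r from .inl hd)])⟩
  induction hu generalizing n s k a with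
  | single hd => exact step h hp hd
  | @tail p r hqp hd ih =>
    obtain ⟨n, s, a, ha, h'⟩ := step h hp hd
    exact ih h' (k := 0) (.inr ⟨fun h => ha h.1, fun h => hq (.inr ⟨_, h, hqp⟩), rfl⟩)

/-- A trail can be prolonged along an inducing path whose edges are all bidirected. -/
theorem Trail.along_inducing {G : LMG V} (hG : G.IsAncestral) {C : Set V} {x : V} {m : ℕ}
    {v : ℕ → V} (hv : G.NodeInducing m v) (hm : 2 ≤ m) {n s k : ℕ} {a : Prop}
    (h : G.Trail C x n s (v 0) a) (hp : G.Pass C (v 0) a True k) :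
    ∃ n s, ∃ a : Prop, a ∧ G.Trail C x n s (v m) a := by
  by_contra hcon
  -- If `v m` cannot be reached, every earlier node can still be reached in a state that allows
  -- leaving along a bidirected edge. A node that may not be passed as a collider is an ancestor of
  -- an endpoint. For `v m` the trail descends to the goal; for `v 0` it restarts at `v 0` and
  -- climbs up to the node.
  have key : ∀ i < m, ∃ n s k, ∃ a : Prop, G.Trail C x n s (v i) a ∧ G.Pass C (v i) a True k := by
    intro i
    induction i with
    | zero => exact fun _ => ⟨n, s, k, a, h, hp⟩
    | succ i ih =>
      intro hi
      obtain ⟨n', s', k', a', h', hp'⟩ := ih (by omega)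
      have hb := hv.bi hG hm (k := i) (by omega)
      have h1 := h'.step (w := v (i + 1)) (adj_iff.2 (.inr (.inl hb)))
        (by rwa [eq_true (show G.Into (v (i + 1)) (v i) from .inr (G.bi_symm hb))])
      by_cases hC : v (i + 1) ∈ C ∪ G.ancestors C
      · obtain ⟨l, hl⟩ := exists_dirDist_iff.2 hC
        exact ⟨_, _, l, _, h1, .inl ⟨.inr hb, trivial, hl⟩⟩
      · rcases (hv.2 i hi).2 with h2 | h2
        · obtain ⟨n₁, s₁, a₁, ha, h3⟩ := h.ascend hG hp hC h2
          exact ⟨_, _, 0, _, h3, .inr ⟨fun h => ha h.1, fun h => hC (.inl h), rfl⟩⟩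
        · exact (hcon (h1.descend hG hC h2)).elim
  obtain ⟨n', s', k', a', h', hp'⟩ := key (m - 1) (by omega)
  have hb := hv.bi hG hm (k := m - 1) (by omega)
  rw [show m - 1 + 1 = m by omega] at hb
  exact hcon ⟨_, _, _, .inr hb, h'.step (adj_iff.2 (.inr (.inl hb)))
    (by rwa [eq_true (show G.Into (v m) (v (m - 1)) from .inr (G.bi_symm hb))])⟩

/-- Each added edge is replaced by a trail along its inducing path. Arriving with an arrowhead at
the far end keeps the later passing conditions intact. -/
theorem exists_trail_of_maximalExtension {G : LMG V} (hG : G.IsAncestral) {C : Set V} {x u : V}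
    {n s : ℕ} {a : Prop} (h : G.maximalExtension.Trail C x n s u a) :
    ∃ n s, G.Trail C x n s u a := by
  have hpass : ∀ {u a b k}, G.maximalExtension.Pass C u a b k → G.Pass C u a b k := by
    intro u a b k h
    simpa only [Pass, maximalExtension_dirDist] using h
  induction h with
  | nil => exact ⟨0, 0, .nil⟩
  | @step n s u a w k h hadj hp ih =>
    obtain ⟨n', s', h'⟩ := ih
    have hp' := hpass hp
    by_cases ha : G.Adj u w
    · rw [maximalExtension_into_iff ha.symm] at hp'
      rw [maximalExtension_into_iff ha]
      exact ⟨_, _, .step h' ha hp'⟩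
    · obtain ⟨hne, hind⟩ := (maximalExtension_adj_iff.1 hadj).resolve_left ha
      have hb : G.maximalExtension.bi u w := .inr ⟨hne, ha, hind⟩
      rw [eq_true (show G.maximalExtension.Into w u from .inr (G.maximalExtension.bi_symm hb))]
        at hp'
      obtain ⟨m, v, hv, rfl, rfl⟩ := hG.isSimple.inducingConnected_iff.1 hind
      obtain ⟨n₁, s₁, a₁, ha₁, h₁⟩ := h'.along_inducing hG hv (hv.two_le hne ha) hp'
      rw [eq_true (show G.maximalExtension.Into (v 0) (v m) from .inr hb)]
      rw [eq_true ha₁] at h₁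
      exact ⟨_, _, h₁⟩

/-- A connecting path of `G` remains one, as neither its colliders nor the ancestral relations
change. The converse goes through trails, since the replacement of added edges may repeat nodes. -/
theorem markovEquiv_maximalExtension {G : LMG V} (hG : G.IsAncestral) :
    G.MarkovEquiv G.maximalExtension := by
  have hG' := maximalExtension_isAncestral hG
  rw [markovEquiv_iff]
  intro C x y hxy
  constructor
  · rw [hG.isSimple.mConnected_iff, hG'.isSimple.mConnected_iff]
    rintro ⟨n, v, h0, hn, h⟩
    have hc : ∀ k, k + 1 < n → (G.maximalExtension.IsCollider (v k) (v (k + 1)) (v (k + 2)) ↔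
        G.IsCollider (v k) (v (k + 1)) (v (k + 2))) := fun k hk => by
      rw [isCollider_iff, isCollider_iff, maximalExtension_into_iff (h.1.1 k (by omega)),
        maximalExtension_into_iff (h.1.1 (k + 1) hk).symm]
    exact ⟨n, v, h0, hn, ⟨fun k hk => maximalExtension_adj_iff.2 (.inl (h.1.1 k hk)), h.1.2⟩,
      fun k hk h' => h.2.1 k hk ((hc k hk).1 h'),
      fun k hk h' => h.2.2.1 k hk (mt (hc k hk).2 h'), h.2.2.2⟩
  · rw [hG.mConnected_iff_exists_trail hxy, hG'.mConnected_iff_exists_trail hxy]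
    rintro ⟨hy, n, s, a, h⟩
    obtain ⟨m, t, ht⟩ := exists_trail_of_maximalExtension hG h
    exact ⟨hy, m, t, a, ht⟩

/-! ### Separation of nonadjacent nodes -/

theorem NodeConnecting.reverse {G : LMG V} {C : Set V} {n : ℕ} {v : ℕ → V}
    (h : G.NodeConnecting C n v) : G.NodeConnecting C n (fun k => v (n - k)) := by
  have e : ∀ k, k + 1 < n → n - (k + 2) + 1 < n ∧ n - (k + 2) + 1 = n - (k + 1) ∧
      n - (k + 2) + 2 = n - k := by omega
  refine ⟨h.1.reverse, fun k hk hc => ?_, fun k hk hc => ?_, by simpa using h.2.2.2.2,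
    by simpa using h.2.2.2.1⟩
  · obtain ⟨e1, e2, e3⟩ := e k hk
    have := h.2.1 _ e1
    rw [e2, e3] at this
    exact this hc.symm
  · obtain ⟨e1, e2, e3⟩ := e k hk
    have := h.2.2.1 _ e1
    rw [e2, e3] at this
    exact this fun hcol => hc hcol.symm

/-- The ancestors of `x` or `y` and the selection adjacent nodes, other than `x` and `y`. -/
def separator (G : LMG V) (x y : V) : Set V :=
  {u | u ≠ x ∧ u ≠ y ∧ (G.IsAncestor u x ∨ G.IsAncestor u y ∨ G.SelectionAdjacent u)}

theorem separator_comm (G : LMG V) (x y : V) : G.separator x y = G.separator y x := by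
  ext u
  simp only [separator, Set.mem_ofPred_eq]
  tauto

/-- The arrowhead at `u` keeps it from being selection-adjacent, and no selection-adjacent node has
proper ancestors, so only the ancestors of `x` or `y` remain. -/
theorem IsAncestral.isAncestor_of_mem_separator {G : LMG V} (hG : G.IsAncestral) {x y t u : V}
    (hu : u ∈ G.separator x y ∪ G.ancestors (G.separator x y)) (ht : G.Into t u) :
    G.IsAncestor u x ∨ G.IsAncestor u y := by
  rcases hu with ⟨-, -, h | h | ⟨w, h⟩⟩ | ⟨z, ⟨-, -, h | h | ⟨w, h⟩⟩, hz⟩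
  · exact .inl h
  · exact .inr h
  · exact (hG.not_und_of_into ht h).elim
  · exact .inl (hz.trans h)
  · exact .inr (hz.trans h)
  · obtain ⟨p, -, hp⟩ := Relation.TransGen.tail'_iff.1 hz
    exact (hG.not_und_of_into (.inl hp) h).elim

/-- Without this arrowhead the node is a noncollider outside the separator, so the path leaves it by
a directed edge. Following the path leads to its last node or to a collider that is an ancestor of
an endpoint, which would put the node into the separator. -/
theorem NodeConnecting.outHead_of_separator {G : LMG V} (hG : G.IsAncestral) {n : ℕ} {v : ℕ → V}
    (h : G.NodeConnecting (G.separator (v 0) (v n)) n v) {k : ℕ} (hk : k + 1 < n) :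
    G.Into (v (k + 2)) (v (k + 1)) := by
  by_contra hc
  have h1 := h.2.2.1 k hk fun h' => hc h'.2.2
  have hne0 : v (k + 1) ≠ v 0 := fun he => by
    have := h.1.2 _ hk.le _ (by omega) he
    omega
  have hnen : v (k + 1) ≠ v n := fun he => by
    have := h.1.2 _ hk.le _ (by omega) he
    omega
  have h2 : ¬ (G.IsAncestor (v (k + 1)) (v 0) ∨ G.IsAncestor (v (k + 1)) (v n) ∨
      G.SelectionAdjacent (v (k + 1))) := fun h' => h1 ⟨hne0, hnen, h'⟩
  push Not at h2
  have hd : G.dir (v (k + 1)) (v (k + 2)) := by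
    rcases adj_iff.1 (h.1.1 (k + 1) hk) with h3 | h3 | h3 | h3
    · exact (h2.2.2 ⟨_, h3⟩).elim
    · exact (hc (.inr (G.bi_symm h3))).elim
    · exact h3
    · exact (hc (.inl h3)).elim
  rcases hG.isAncestor_or_collider h.1.1 hd hk le_rfl with ⟨h3, -⟩ | ⟨l, hl1, hl2, h3, h4, h5⟩
  · exact h2.2.1 h3
  · obtain ⟨l, rfl⟩ : ∃ j, l = j + 1 := ⟨l - 1, by omega⟩
    have hcol : G.IsCollider (v l) (v (l + 1)) (v (l + 2)) := by
      refine ⟨fun he => ?_, h4, h5⟩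
      have := h.1.2 _ (by omega) _ (by omega) he
      omega
    rcases hG.isAncestor_of_mem_separator (h.2.1 l hl2 hcol) h4 with h6 | h6
    · exact h2.1 (h3.trans h6)
    · exact h2.2.1 (h3.trans h6)

/-- Applied in both directions, the previous lemma makes every inner node of a connecting path a
collider that is an ancestor of an endpoint. Such a path is inducing. -/
theorem IsAncestral.not_mConnected_separator {G : LMG V} (hG : G.IsAncestral) {x y : V}
    (hind : ¬ G.InducingConnected x y) : ¬ G.MConnected (G.separator x y) x y := by
  rw [hG.isSimple.mConnected_iff]
  rintro ⟨n, v, rfl, rfl, h⟩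
  refine hind (hG.isSimple.inducingConnected_iff.2 ⟨n, v, ⟨h.1, fun k hk => ?_⟩, rfl, rfl⟩)
  have h1 := h.outHead_of_separator hG hk
  have h2 : G.Into (v k) (v (k + 1)) := by
    have h' := h.reverse
    rw [separator_comm] at h'
    have := NodeConnecting.outHead_of_separator hG (v := fun k => v (n - k)) (n := n)
      (by simpa using h') (k := n - (k + 2)) (by omega)
    simpa only [show n - (n - (k + 2) + 2) = k by omega,
      show n - (n - (k + 2) + 1) = k + 1 by omega] using this
  have hcol : G.IsCollider (v k) (v (k + 1)) (v (k + 2)) := by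
    refine ⟨fun he => ?_, h2, h1⟩
    have := h.1.2 _ (by omega) _ (by omega) he
    omega
  exact ⟨hcol, hG.isAncestor_of_mem_separator (h.2.1 k hk hcol) h2⟩

/-- Nodes nonadjacent in the extension are separated in `G`, hence in its Markov equivalent
extension. An inducing path there would connect them, because its colliders all lie in the
separator. -/
theorem maximalExtension_isMaximal {G : LMG V} (hG : G.IsAncestral) :
    G.maximalExtension.IsMaximal := by
  intro i j hij hind
  have hG' := maximalExtension_isAncestral hG
  by_contra hadj
  have h1 : ¬ G.InducingConnected i j := fun h => hadj (maximalExtension_adj_iff.2 (.inr ⟨hij, h⟩))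
  have h2 := mt (markovEquiv_iff.1 (markovEquiv_maximalExtension hG) _ _ _ hij).2
    (hG.not_mConnected_separator h1)
  rw [hG'.isSimple.mConnected_iff] at h2
  obtain ⟨n, v, hv, rfl, rfl⟩ := hG'.isSimple.inducingConnected_iff.1 hind
  refine h2 ⟨n, v, rfl, rfl, hv.1, fun k hk _ => .inl ⟨fun he => ?_, fun he => ?_, ?_⟩,
    fun k hk h => (h (hv.2 k hk).1).elim, fun h => h.1 rfl, fun h => h.2.1 rfl⟩
  · have := hv.1.2 _ (by omega) _ (by omega) he
    omega
  · have := hv.1.2 _ (by omega) _ (by omega) he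
    omega
  · exact (hv.2 k hk).2.imp id .inl

end LMG

namespace LMG

variable {V : Type*}

/-! ### Triples with order -/

/-- The triple has some order. -/
def Ordered (G : LMG V) (i j k : V) : Prop := ∃ t, G.TripleOfOrderLE t i j k

theorem TripleOfOrderLE.mono {G : LMG V} {s t : ℕ} {i j k : V} (h : G.TripleOfOrderLE s i j k)
    (hst : s ≤ t) : G.TripleOfOrderLE t i j k := by
  induction hst with
  | refl => exact h
  | step _ ih => exact .inl ih

theorem TripleOfOrderLE.symm {G : LMG V} {t : ℕ} {i j k : V} (h : G.TripleOfOrderLE t i j k) :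
    G.TripleOfOrderLE t k j i := by
  induction t with
  | zero => exact ⟨⟨h.1.1.symm, h.1.2.2.symm, h.1.2.1.symm⟩, fun h' => h.2 h'.symm⟩
  | succ t ih =>
    rcases h with h | ⟨m, v, e, h1, h2, h3⟩
    · exact .inl (ih h)
    · exact .inr ⟨m, v, e, h1, h2, h3.symm⟩

theorem Ordered.symm {G : LMG V} {i j k : V} (h : G.Ordered i j k) : G.Ordered k j i :=
  h.imp fun _ h => h.symm

theorem mem_collidersWithOrder_iff {G : LMG V} {i j k : V} :
    (i, j, k) ∈ G.collidersWithOrder ↔ G.IsCollider i j k ∧ G.Ordered i j k := by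
  classical
  refine and_congr_right fun _ => ⟨fun ⟨t, h⟩ => ⟨t, h.1⟩, fun h => ?_⟩
  exact ⟨Nat.find h, Nat.find_spec h, fun s hs => Nat.find_min h hs⟩

theorem NodeDiscriminating.tripleOfOrderLE {G : LMG V} (hG : G.IsSimple) {m t : ℕ} {v : ℕ → V}
    (h : G.NodeDiscriminating m v)
    (ht : ∀ l < m, G.TripleOfOrderLE t (v l) (v (l + 1)) (v (l + 2))) :
    G.TripleOfOrderLE (t + 1) (v m) (v (m + 1)) (v (m + 2)) := by
  obtain ⟨e, h⟩ := hG.exists_isDiscriminatingPath_iff.2 h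
  exact .inr ⟨m, v, e, h, ht, .inl ⟨rfl, rfl, rfl⟩⟩

theorem NodeDiscriminating.ordered {G : LMG V} (hG : G.IsSimple) {m : ℕ} {v : ℕ → V}
    (h : G.NodeDiscriminating m v) (ht : ∀ l < m, G.Ordered (v l) (v (l + 1)) (v (l + 2))) :
    G.Ordered (v m) (v (m + 1)) (v (m + 2)) := by
  have : ∀ l, ∃ t, l < m → G.TripleOfOrderLE t (v l) (v (l + 1)) (v (l + 2)) := by
    intro l
    by_cases hl : l < m
    · exact (ht l hl).imp fun _ h _ => h
    · exact ⟨0, fun h => (hl h).elim⟩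
  choose t ht using this
  exact ⟨_, h.tripleOfOrderLE hG (t := (Finset.range m).sup t) fun l hl =>
    (ht l hl).mono (Finset.le_sup (f := t) (Finset.mem_range.2 hl))⟩

/-- The sequence `v 0, …, v k, c, c, …`. -/
def truncate (v : ℕ → V) (k : ℕ) (c : V) : ℕ → V := fun l => if l ≤ k then v l else c

theorem truncate_of_le {v : ℕ → V} {k l : ℕ} {c : V} (h : l ≤ k) : truncate v k c l = v l :=
  if_pos h

theorem truncate_of_lt {v : ℕ → V} {k l : ℕ} {c : V} (h : k < l) : truncate v k c l = c :=
  if_neg (by omega)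

theorem nodeDiscriminating_truncate {G : LMG V} {k : ℕ} {v : ℕ → V} {c : V}
    (hv : G.IsNodePath (k + 1) v) (hc : ∀ l ≤ k + 1, v l ≠ c) (hadj : G.Adj (v (k + 1)) c)
    (hn : ¬ G.Adj (v 0) c)
    (hd : ∀ l < k, G.IsCollider (v l) (v (l + 1)) (v (l + 2)) ∧ G.dir (v (l + 1)) c) :
    G.NodeDiscriminating k (truncate v (k + 1) c) := by
  have hlast : truncate v (k + 1) c (k + 2) = c := truncate_of_lt (by omega)
  refine ⟨⟨fun l hl => ?_, fun l hl l' hl' he => ?_⟩, ?_, fun l hl => ?_⟩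
  · rcases (show l ≤ k + 1 by omega).lt_or_eq with h | rfl
    · rw [truncate_of_le (by omega), truncate_of_le (by omega)]
      exact hv.1 l h
    · rwa [truncate_of_le le_rfl, hlast]
  · rcases hl.lt_or_eq with h | rfl <;> rcases hl'.lt_or_eq with h' | rfl
    · rw [truncate_of_le (by omega), truncate_of_le (by omega)] at he
      exact hv.2 l (by omega) l' (by omega) he
    · rw [truncate_of_le (by omega), hlast] at he
      exact (hc l (by omega) he).elim
    · rw [truncate_of_le (k := k + 1) (l := l') (by omega), hlast] at he
      exact (hc l' (by omega) he.symm).elim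
    · rfl
  · rwa [hlast, truncate_of_le (by omega)]
  · rw [hlast, truncate_of_le (by omega), truncate_of_le (by omega), truncate_of_le (by omega)]
    exact hd l hl

/-- On common discriminating paths whose triples have order, the discriminated triple is a collider
either in both graphs or in none. -/
def AgreeOnDiscriminated (G H : LMG V) : Prop :=
  ∀ m v, G.NodeDiscriminating m v → H.NodeDiscriminating m v →
    (∀ l < m, G.Ordered (v l) (v (l + 1)) (v (l + 2))) →
    (∀ l < m, H.Ordered (v l) (v (l + 1)) (v (l + 2))) →
    (G.IsCollider (v m) (v (m + 1)) (v (m + 2)) ↔ H.IsCollider (v m) (v (m + 1)) (v (m + 2)))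

theorem AgreeOnDiscriminated.symm {G H : LMG V} (h : G.AgreeOnDiscriminated H) :
    H.AgreeOnDiscriminated G :=
  fun m v h1 h2 h3 h4 => (h m v h2 h1 h4 h3).symm

theorem IsNodePath.congr {G H : LMG V} (hadj : ∀ x y, G.Adj x y ↔ H.Adj x y) {n : ℕ} {v : ℕ → V}
    (h : G.IsNodePath n v) : H.IsNodePath n v :=
  ⟨fun k hk => (hadj _ _).1 (h.1 k hk), h.2⟩

/-- Only the edges to the last node `c` are at issue. Cutting the path after `v (k + 1)` and going
straight to `c` gives a path that, by induction on `k`, discriminates `v (k + 1)` in both graphs. It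
is a noncollider in `G`, so in `H` its edge to `c` is directed as well. -/
theorem NodeDiscriminating.transfer {G H : LMG V} (hG : G.IsAncestral) (hH : H.IsAncestral)
    (hadj : ∀ x y, G.Adj x y ↔ H.Adj x y) (hQ : G.AgreeOnDiscriminated H) {m : ℕ} {v : ℕ → V}
    (h : G.NodeDiscriminating m v) (hoG : ∀ l < m, G.Ordered (v l) (v (l + 1)) (v (l + 2)))
    (hoH : ∀ l < m, H.Ordered (v l) (v (l + 1)) (v (l + 2)))
    (hc : ∀ l < m, H.IsCollider (v l) (v (l + 1)) (v (l + 2))) : H.NodeDiscriminating m v := by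
  obtain ⟨hp, hn, hd⟩ := h
  have hnH : ¬ H.Adj (v 0) (v (m + 2)) := mt (hadj _ _).2 hn
  refine ⟨hp.congr hadj, hnH, fun k hk => ⟨hc k hk, ?_⟩⟩
  induction k using Nat.strong_induction_on with
  | _ k ih =>
    have hpG : G.IsNodePath (k + 1) v :=
      ⟨fun l hl => hp.1 l (by omega), fun l hl l' hl' => hp.2 l (by omega) l' (by omega)⟩
    have hne : ∀ l ≤ k + 1, v l ≠ v (m + 2) := fun l hl he => by
      have := hp.2 l (by omega) _ le_rfl he
      omega
    have hkc : G.Adj (v (k + 1)) (v (m + 2)) := adj_iff.2 (.inr (.inr (.inl (hd k hk).2)))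
    have hdG := nodeDiscriminating_truncate hpG hne hkc hn fun l hl => hd l (by omega)
    have hdH := nodeDiscriminating_truncate (hpG.congr hadj) hne ((hadj _ _).1 hkc) hnH
      fun l hl => ⟨hc l (by omega), ih l hl (by omega)⟩
    have hiff := hQ k _ hdG hdH
      (fun l hl => by
        rw [truncate_of_le (by omega), truncate_of_le (by omega), truncate_of_le (by omega)]
        exact hoG l (by omega))
      (fun l hl => by
        rw [truncate_of_le (by omega), truncate_of_le (by omega), truncate_of_le (by omega)]
        exact hoH l (by omega))
    rw [truncate_of_le (by omega), truncate_of_le (by omega), truncate_of_lt (by omega)] at hiff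
    refine hH.dir_of_not_into (hc k hk).2.1 ((hadj _ _).1 hkc) fun h' => ?_
    exact hG.not_into_of_dir (hd k hk).2
      (hiff.2 ⟨hne k (by omega), (hc k hk).2.1, h'⟩).2.2

theorem nodeDiscriminating_zero {G : LMG V} {i j k : V} (h : G.IsTriple i j k)
    (hn : ¬ G.Adj i k) : G.NodeDiscriminating 0 (fun l => if l = 0 then i else if l = 1 then j
      else k) := by
  refine ⟨⟨fun l hl => ?_, fun l hl l' hl' he => ?_⟩, by simpa using hn, fun l hl => by omega⟩
  · interval_cases l
    · simpa using h.2.1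
    · simpa using h.2.2
  · have h1 := h.1
    have h2 := h.2.1.ne
    have h3 := h.2.2.ne
    interval_cases l <;> interval_cases l' <;> simp_all [eq_comm]

/-- Order and collider status must be transferred together: the colliders on a discriminating path
are triples of smaller order, and their transfer makes the path discriminating in `H`. Unshielded
triples are the discriminating paths with `m = 0`. -/
theorem AgreeOnDiscriminated.transfer {G H : LMG V} (hG : G.IsAncestral) (hH : H.IsAncestral)
    (hadj : ∀ x y, G.Adj x y ↔ H.Adj x y) (hQ : G.AgreeOnDiscriminated H) {t : ℕ} {i j k : V}
    (h : G.TripleOfOrderLE t i j k) :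
    H.TripleOfOrderLE t i j k ∧ (G.IsCollider i j k ↔ H.IsCollider i j k) := by
  induction t generalizing i j k with
  | zero =>
    have h' : H.IsTriple i j k ∧ ¬ H.Adj i k :=
      ⟨⟨h.1.1, (hadj _ _).1 h.1.2.1, (hadj _ _).1 h.1.2.2⟩, mt (hadj _ _).2 h.2⟩
    refine ⟨h', ?_⟩
    simpa using hQ 0 _ (nodeDiscriminating_zero h.1 h.2) (nodeDiscriminating_zero h'.1 h'.2)
      (by simp) (by simp)
  | succ t ih =>
    rcases h with h | ⟨m, v, e, h1, h2, h3⟩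
    · exact ⟨.inl (ih h).1, (ih h).2⟩
    · have hd := hG.isSimple.exists_isDiscriminatingPath_iff.1 ⟨e, h1⟩
      have hoH : ∀ l < m, H.TripleOfOrderLE t (v l) (v (l + 1)) (v (l + 2)) :=
        fun l hl => (ih (h2 l hl)).1
      have hdH := hd.transfer hG hH hadj hQ (fun l hl => ⟨t, h2 l hl⟩)
        (fun l hl => ⟨t, hoH l hl⟩) fun l hl => (ih (h2 l hl)).2.1 (hd.2.2 l hl).1
      have hc := hQ m v hd hdH (fun l hl => ⟨t, h2 l hl⟩) fun l hl => ⟨t, hoH l hl⟩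
      have ho := hdH.tripleOfOrderLE hH.isSimple hoH
      rcases h3 with ⟨rfl, rfl, rfl⟩ | ⟨rfl, rfl, rfl⟩
      · exact ⟨ho, hc⟩
      · exact ⟨ho.symm, ⟨fun h => (hc.1 h.symm).symm, fun h => (hc.2 h.symm).symm⟩⟩

theorem AgreeOnDiscriminated.ordered {G H : LMG V} (hG : G.IsAncestral) (hH : H.IsAncestral)
    (hadj : ∀ x y, G.Adj x y ↔ H.Adj x y) (hQ : G.AgreeOnDiscriminated H) {i j k : V}
    (h : G.Ordered i j k) :
    H.Ordered i j k ∧ (G.IsCollider i j k ↔ H.IsCollider i j k) := by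
  obtain ⟨t, h⟩ := h
  exact ⟨⟨t, (hQ.transfer hG hH hadj h).1⟩, (hQ.transfer hG hH hadj h).2⟩

theorem AgreeOnDiscriminated.collidersWithOrder_eq {G H : LMG V} (hG : G.IsAncestral)
    (hH : H.IsAncestral) (hadj : ∀ x y, G.Adj x y ↔ H.Adj x y) (hQ : G.AgreeOnDiscriminated H) :
    G.collidersWithOrder = H.collidersWithOrder := by
  ext ⟨i, j, k⟩
  rw [mem_collidersWithOrder_iff, mem_collidersWithOrder_iff]
  constructor
  · rintro ⟨hc, ho⟩
    have := hQ.ordered hG hH hadj ho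
    exact ⟨this.2.1 hc, this.1⟩
  · rintro ⟨hc, ho⟩
    have := hQ.symm.ordered hH hG (fun x y => (hadj x y).symm) ho
    exact ⟨this.2.1 hc, this.1⟩

theorem agreeOnDiscriminated_of_collidersWithOrder_eq {G H : LMG V} (hG : G.IsSimple)
    (hH : H.IsSimple) (h : G.collidersWithOrder = H.collidersWithOrder) :
    G.AgreeOnDiscriminated H := by
  intro m v hdG hdH hoG hoH
  have h1 := hdG.ordered hG hoG
  have h2 := hdH.ordered hH hoH
  have h3 : (v m, v (m + 1), v (m + 2)) ∈ G.collidersWithOrder ↔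
      (v m, v (m + 1), v (m + 2)) ∈ H.collidersWithOrder := by rw [h]
  simpa [mem_collidersWithOrder_iff, h1, h2] using h3

/-! ### Markov equivalent maximal ancestral graphs have the same colliders with order -/

/-- Moving along the path, each collider must lie in `C`, since otherwise it could be left directly
to the last node, connecting the ends. So `v (m + 1)` is reached, and separation means that exactly
the wrong passing condition holds there. -/
theorem NodeDiscriminating.isCollider_iff_notMem {G : LMG V} (hG : G.IsAncestral) {m : ℕ}
    {v : ℕ → V} (h : G.NodeDiscriminating m v) {C : Set V} (h0 : v 0 ∉ C) (hm : v (m + 2) ∉ C)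
    (hsep : ¬ G.MConnected C (v 0) (v (m + 2))) :
    G.IsCollider (v m) (v (m + 1)) (v (m + 2)) ↔ v (m + 1) ∉ C := by
  obtain ⟨hp, -, hd⟩ := h
  have hne : ∀ l < m + 2, v l ≠ v (m + 2) := fun l hl he => by
    have := hp.2 l hl.le _ le_rfl he
    omega
  rw [hG.mConnected_iff_exists_trail (hne 0 (by omega))] at hsep
  have hno : ∀ n s a, ¬ G.Trail C (v 0) n s (v (m + 2)) a := fun n s a h => hsep ⟨hm, n, s, a, h⟩
  have key : ∀ k ≤ m, ∃ s, G.Trail C (v 0) (k + 1) s (v (k + 1)) (G.Into (v k) (v (k + 1))) := by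
    intro k
    induction k with
    | zero =>
      exact fun _ => ⟨_, .step .nil (hp.1 0 (by omega)) (.inr ⟨fun h => h.1, h0, rfl⟩)⟩
    | succ k ih =>
      intro hk
      obtain ⟨s, hs⟩ := ih (by omega)
      obtain ⟨hc, hd⟩ := hd k hk
      have hmem : v (k + 1) ∈ C := by
        by_contra hmem
        exact hno _ _ _ (.step hs (adj_iff.2 (.inr (.inr (.inl hd))))
          (.inr ⟨fun h => hG.not_into_of_dir hd h.2, hmem, rfl⟩))
      exact ⟨_, .step (k := 0) hs (hp.1 (k + 1) (by omega)) (.inl ⟨hc.2.1, hc.2.2, hmem⟩)⟩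
  obtain ⟨s, hs⟩ := key m le_rfl
  have hpass : ∀ k, ¬ G.Pass C (v (m + 1)) (G.Into (v m) (v (m + 1)))
      (G.Into (v (m + 2)) (v (m + 1))) k :=
    fun k hk => hno _ _ _ (.step hs (hp.1 (m + 1) (by omega)) hk)
  constructor
  · exact fun hc hmem => hpass 0 (.inl ⟨hc.2.1, hc.2.2, hmem⟩)
  · intro hmem
    by_contra hc
    exact hpass 0 (.inr ⟨fun h => hc ⟨hne m (by omega), h⟩, hmem, rfl⟩)

/-- An edge connects its ends given any set avoiding them, whereas the separator in `G` would
separate them unless an inducing path makes them adjacent by maximality. -/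
theorem MarkovEquiv.adj_of_adj {G H : LMG V} (hG : G.IsAncestral) (hH : H.IsAncestral)
    (hm : G.IsMaximal) (h : G.MarkovEquiv H) {x y : V} (hxy : H.Adj x y) : G.Adj x y := by
  refine hm x y hxy.ne (by_contra fun hind => ?_)
  refine hG.not_mConnected_separator hind ((markovEquiv_iff.1 h _ _ _ hxy.ne).2 ?_)
  rw [hH.isSimple.mConnected_iff]
  exact ⟨1, _, by simp, by simp, .of_adj hxy (fun h => h.1 rfl) (fun h => h.2.1 rfl)⟩

theorem MarkovEquiv.adj_iff {G H : LMG V} (hG : G.IsAncestral) (hH : H.IsAncestral)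
    (hGm : G.IsMaximal) (hHm : H.IsMaximal) (h : G.MarkovEquiv H) (x y : V) :
    G.Adj x y ↔ H.Adj x y :=
  ⟨MarkovEquiv.adj_of_adj hH hG hHm h.symm, h.adj_of_adj hG hH hGm⟩

theorem MarkovEquiv.agreeOnDiscriminated {G H : LMG V} (hG : G.IsAncestral) (hH : H.IsAncestral)
    (hGm : G.IsMaximal) (h : G.MarkovEquiv H) : G.AgreeOnDiscriminated H := by
  intro m v hdG hdH _ _
  have hne : v 0 ≠ v (m + 2) := fun he => by
    have := hdG.1.2 0 (by omega) _ le_rfl he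
    omega
  have hsep := hG.not_mConnected_separator fun hind => hdG.2.1 (hGm _ _ hne hind)
  rw [hdG.isCollider_iff_notMem hG (fun h => h.1 rfl) (fun h => h.2.1 rfl) hsep,
    hdH.isCollider_iff_notMem hH (fun h => h.1 rfl) (fun h => h.2.1 rfl)
      (mt (markovEquiv_iff.1 h _ _ _ hne).2 hsep)]

end LMG

namespace LMG

variable {V : Type*}

/-! ### Triples on minimal connecting walks -/

/-- The node `v k` is a collider on the walk. -/
def ColAt (G : LMG V) (n : ℕ) (v : ℕ → V) (k : ℕ) : Prop := G.InHead v k ∧ G.OutHead n v k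

theorem colAt_reverse {G : LMG V} {n k : ℕ} {v : ℕ → V} (hk : k ≤ n) :
    G.ColAt n (fun k => v (n - k)) k ↔ G.ColAt n v (n - k) := by
  rw [ColAt, inHead_reverse hk, outHead_reverse hk, ColAt, and_comm]

theorem IsNodePath.isCollider_iff {G : LMG V} {n k : ℕ} {v : ℕ → V} (h : G.IsNodePath n v)
    (hk : k + 1 < n) : G.IsCollider (v k) (v (k + 1)) (v (k + 2)) ↔ G.ColAt n v (k + 1) := by
  refine ⟨fun hc => ⟨⟨by omega, hc.2.1⟩, hk, hc.2.2⟩, fun hc => ⟨fun he => ?_, hc.1.2, hc.2.2⟩⟩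
  have := h.2 k (by omega) (k + 2) (by omega) he
  omega

theorem exists_last_not {P : ℕ → Prop} (h0 : ¬ P 0) {i : ℕ} (hi : 0 < i) :
    ∃ j < i, ¬ P j ∧ ∀ k, j < k → k < i → P k := by
  induction i with
  | zero => omega
  | succ i ih =>
    by_cases hP : P i
    · have : i ≠ 0 := by rintro rfl; exact h0 hP
      obtain ⟨j, h1, h2, h3⟩ := ih (by omega)
      refine ⟨j, by omega, h2, fun k hk hk' => ?_⟩
      rcases Nat.lt_succ_iff_lt_or_eq.1 hk' with h | rfl
      exacts [h3 k hk h, hP]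
    · exact ⟨i, by omega, hP, fun k hk hk' => by omega⟩

/-- When the walk turns off from `v j` to `c`, its status at `v j` is unchanged: a collider could
only be lost by `v j → c`, which is excluded, and `v j → v (j + 1) → c` forbids a new arrowhead at
`v j`. Keeping the weight `w j` matters for the comparison of total weights. -/
theorem ConnWalk.pass_jump {G : LMG V} (hG : G.IsAncestral) {C : Set V} {n : ℕ} {v : ℕ → V}
    {w : ℕ → ℕ} (h : G.ConnWalk C n v w) {j : ℕ} {c : V} (hj : j < n)
    (hin : G.Into (v j) (v (j + 1))) (hd : G.dir (v (j + 1)) c) (hadj : G.Adj (v j) c)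
    (hn : ¬ (G.ColAt n v j ∧ G.dir (v j) c)) :
    G.Pass C (v j) (G.InHead v j) (G.Into c (v j)) (w j) := by
  have hp := h.pass j hj.le
  by_cases ha : G.InHead v j
  · by_cases hb : G.OutHead n v j
    · have hc : G.Into c (v j) := by
        by_contra hc
        exact hn ⟨⟨ha, hb⟩, hG.dir_of_not_into ha.2 hadj hc⟩
      exact .inl ⟨ha, hc, hp.dirDist ha hb⟩
    · have h1 : G.dir (v j) (v (j + 1)) :=
        hG.dir_of_not_into ha.2 hin.adj fun h' => hb ⟨hj, h'⟩
      have h2 := hG.not_into_of_isAncestor ((isAncestor_of_dir h1).trans (isAncestor_of_dir hd))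
      rcases hp with hp | hp
      · exact (hb hp.2.1).elim
      · exact .inr ⟨fun h => h2 h.2, hp.2⟩
  · rcases hp with hp | hp
    · exact (ha hp.1).elim
    · exact .inr ⟨fun h => ha h.1, hp.2⟩

/-- If `v i` has an arrowhead from the left and is a parent of `d`, then either a discriminating
piece of the walk ends in `v i`, or the walk can be redirected to `d` before `v i`. -/
theorem ConnWalk.discriminating_or_trail {G : LMG V} (hG : G.IsAncestral) {C : Set V} {n : ℕ}
    {v : ℕ → V} {w : ℕ → ℕ} (h : G.ConnWalk C n v w) {i : ℕ} {d : V} (hi : i ≤ n)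
    (hin : G.InHead v i) (hd : G.dir (v i) d) :
    (∃ j < i, ¬ G.Adj (v j) d ∧ ∀ k, j < k → k < i → G.ColAt n v k ∧ G.dir (v k) d) ∨
      ∃ j < i, G.Into (v j) d ∧
        G.Trail C (v 0) (j + 1) (∑ l ∈ Finset.range (j + 1), w l) d (G.Into (v j) d) := by
  -- `j` is the last position before `i` that is not a collider and parent of `d`; position `0`
  -- qualifies because an endpoint is never a collider.
  obtain ⟨j, hj, h1, h2⟩ := exists_last_not (P := fun k => G.ColAt n v k ∧ G.dir (v k) d)
    (fun h => absurd h.1.1.1 (by omega)) hin.1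
  by_cases hadj : G.Adj (v j) d
  · have h3 : G.Into (v j) (v (j + 1)) ∧ G.dir (v (j + 1)) d := by
      rcases (show j + 1 ≤ i by omega).lt_or_eq with h3 | rfl
      · exact ⟨(h2 _ (by omega) h3).1.1.2, (h2 _ (by omega) h3).2⟩
      · exact ⟨hin.2, hd⟩
    refine .inr ⟨j, hj, hG.into_of_into_of_dir h3.1 h3.2 hadj, ?_⟩
    rw [Finset.sum_range_succ]
    exact .step (h.trail (by omega)) hadj (h.pass_jump hG (by omega) h3.1 h3.2 hadj h1)
  · exact .inl ⟨j, hj, hadj, h2⟩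

/-- If the shortcut makes `v j` a new collider, then `v j → v (j + 1)`, and `v (j + 1)` must have
been a collider, since otherwise `v j` would be an ancestor of `v (j + 2)`. So `v j` inherits a
directed walk to `C`, one edge longer. -/
theorem ConnWalk.pass_shortcut {G : LMG V} (hG : G.IsAncestral) {C : Set V} {n : ℕ} {v : ℕ → V}
    {w : ℕ → ℕ} (h : G.ConnWalk C n v w) {j : ℕ} (hj : j + 2 ≤ n)
    (hadj : G.Adj (v j) (v (j + 2))) (hn : ¬ (G.ColAt n v j ∧ G.dir (v j) (v (j + 2)))) :
    ∃ k, G.Pass C (v j) (G.InHead v j) (G.Into (v (j + 2)) (v j)) k := by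
  have hp := h.pass j (by omega)
  by_cases ha : G.InHead v j
  · by_cases hb : G.OutHead n v j
    · have hc : G.Into (v (j + 2)) (v j) := by
        by_contra hc
        exact hn ⟨⟨ha, hb⟩, hG.dir_of_not_into ha.2 hadj hc⟩
      exact ⟨_, .inl ⟨ha, hc, hp.dirDist ha hb⟩⟩
    · by_cases hc : G.Into (v (j + 2)) (v j)
      · have h1 : G.dir (v j) (v (j + 1)) :=
          hG.dir_of_not_into ha.2 (h.adj j (by omega)) fun h' => hb ⟨by omega, h'⟩
        have h2 : G.Into (v (j + 2)) (v (j + 1)) := by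
          by_contra h2
          have h3 := hG.dir_of_not_into (.inl h1) (h.adj (j + 1) (by omega)) h2
          exact hG.not_into_of_isAncestor
            ((isAncestor_of_dir h1).trans (isAncestor_of_dir h3)) hc
        have h3 := (h.pass (j + 1) (by omega)).dirDist ⟨by omega, .inl h1⟩ ⟨by omega, h2⟩
        exact ⟨w (j + 1) + 1, .inl ⟨ha, hc, v (j + 1), h1, h3⟩⟩
      · exact ⟨0, .inr ⟨fun h => hc h.2, hp.notMem fun h => hb h.2, rfl⟩⟩
  · exact ⟨0, .inr ⟨fun h => ha h.1, hp.notMem fun h => ha h.1, rfl⟩⟩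

/-- Otherwise both ends of the shortcut could be passed, giving a walk with one edge less. -/
theorem MinWalk.colAt_of_adj {G : LMG V} (hG : G.IsAncestral) {C : Set V} {n : ℕ} {v : ℕ → V}
    {w : ℕ → ℕ} (h : G.MinWalk C n v w) {j : ℕ} (hj : j + 2 ≤ n)
    (hadj : G.Adj (v j) (v (j + 2))) :
    (G.ColAt n v j ∧ G.dir (v j) (v (j + 2))) ∨
      (G.ColAt n v (j + 2) ∧ G.dir (v (j + 2)) (v j)) := by
  by_contra hcon
  rw [not_or] at hcon
  obtain ⟨k, hk⟩ := h.toConnWalk.pass_shortcut hG hj hadj hcon.1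
  have e1 : n - (n - (j + 2)) = j + 2 := by omega
  have e2 : n - (n - (j + 2) + 2) = j := by omega
  have hr := h.toConnWalk.reverse.pass_shortcut hG (j := n - (j + 2)) (by omega)
    (by simpa only [e1, e2] using hadj.symm)
    (by simpa only [colAt_reverse (show n - (j + 2) ≤ n by omega), e1, e2] using hcon.2)
  rw [inHead_reverse (by omega)] at hr
  simp only [e1, e2] at hr
  obtain ⟨l, hl⟩ := hr
  have := (h.min (.step (h.toConnWalk.trail (by omega)) hadj hk)
    (h.toConnWalk.trail_reverse hj) hl.symm).1
  omega

/-- The triple at `v i` is discriminated by the piece of the walk that starts in `v j`. -/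
def LeftDisc (G : LMG V) (n : ℕ) (v : ℕ → V) (i j : ℕ) : Prop :=
  j + 1 < i ∧ ¬ G.Adj (v j) (v (i + 1)) ∧
    ∀ k, j < k → k < i → G.ColAt n v k ∧ G.dir (v k) (v (i + 1))

/-- The triple at `v i` is discriminated by the piece of the walk that ends in `v r`. -/
def RightDisc (G : LMG V) (n : ℕ) (v : ℕ → V) (i r : ℕ) : Prop :=
  i + 1 < r ∧ r ≤ n ∧ ¬ G.Adj (v (i - 1)) (v r) ∧
    ∀ k, i < k → k < r → G.ColAt n v k ∧ G.dir (v k) (v (i - 1))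

/-- The alternative is an earlier jump to `v (j + 2)`. It arrives with an arrowhead, as the original
edge does, so the rest of the walk could follow and the walk would not be shortest. -/
theorem MinWalk.exists_leftDisc {G : LMG V} (hG : G.IsAncestral) {C : Set V} {n : ℕ} {v : ℕ → V}
    {w : ℕ → ℕ} (h : G.MinWalk C n v w) {j : ℕ} (hj : j + 2 ≤ n)
    (hc : G.ColAt n v j) (hd : G.dir (v j) (v (j + 2))) : ∃ l, G.LeftDisc n v (j + 1) l := by
  rcases h.toConnWalk.discriminating_or_trail hG (by omega) hc.1 hd with
    ⟨l, h1, h2, h3⟩ | ⟨l, h1, h2, h3⟩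
  · refine ⟨l, by omega, h2, fun k hk hk' => ?_⟩
    rcases Nat.lt_succ_iff_lt_or_eq.1 hk' with h4 | rfl
    · exact h3 k hk h4
    · exact ⟨hc, hd⟩
  · have h4 : G.Into (v (j + 1)) (v (j + 2)) :=
      hG.into_of_into_of_dir hc.2.2 hd (h.adj (j + 1) (by omega))
    have h5 := h.pass (j + 2) hj
    rw [show G.InHead v (j + 2) = G.Into (v l) (v (j + 2)) from
      propext ⟨fun _ => h2, fun _ => ⟨by omega, h4⟩⟩] at h5
    have := (h.min h3 (h.toConnWalk.trail_reverse hj) h5).1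
    omega

theorem LeftDisc.rightDisc_of_reverse {G : LMG V} {n i j : ℕ} {v : ℕ → V} (hi : 0 < i)
    (hin : i < n) (h : G.LeftDisc n (fun k => v (n - k)) (n - i) j) :
    G.RightDisc n v i (n - j) := by
  obtain ⟨h1, h2, h3⟩ := h
  have e : n - (n - i + 1) = i - 1 := by omega
  simp only [e] at h2 h3
  refine ⟨by omega, by omega, fun h => h2 h.symm, fun k hk hk' => ?_⟩
  obtain ⟨h4, h5⟩ := h3 (n - k) (by omega) (by omega)
  rw [colAt_reverse (by omega)] at h4
  rw [show n - (n - k) = k by omega] at h4 h5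
  exact ⟨h4, h5⟩

theorem MinWalk.leftDisc_or_rightDisc {G : LMG V} (hG : G.IsAncestral) {C : Set V} {n : ℕ}
    {v : ℕ → V} {w : ℕ → ℕ} (h : G.MinWalk C n v w) {i : ℕ} (hi : 0 < i) (hin : i < n)
    (hadj : G.Adj (v (i - 1)) (v (i + 1))) :
    (∃ j, G.LeftDisc n v i j) ∨ ∃ r, G.RightDisc n v i r := by
  obtain ⟨j, rfl⟩ : ∃ j, i = j + 1 := ⟨i - 1, by omega⟩
  rcases h.colAt_of_adj hG (j := j) (by omega) hadj with h1 | h1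
  · exact .inl (h.exists_leftDisc hG (by omega) h1.1 h1.2)
  · have e1 : n - (n - (j + 2)) = j + 2 := by omega
    have e2 : n - (n - (j + 2) + 2) = j := by omega
    obtain ⟨l, hl⟩ := h.reverse.exists_leftDisc hG (j := n - (j + 2)) (by omega)
      (by rw [colAt_reverse (by omega), e1]; exact h1.1) (by simpa only [e1, e2] using h1.2)
    rw [show n - (j + 2) + 1 = n - (j + 1) by omega] at hl
    exact .inr ⟨_, hl.rightDisc_of_reverse (by omega) hin⟩

theorem LeftDisc.ordered {G : LMG V} (hG : G.IsSimple) {n i j : ℕ} {v : ℕ → V}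
    (hp : G.IsNodePath n v) (hin : i < n) (h : G.LeftDisc n v i j)
    (ho : ∀ k, j < k → k < i → G.Ordered (v (k - 1)) (v k) (v (k + 1))) :
    G.Ordered (v (i - 1)) (v i) (v (i + 1)) := by
  obtain ⟨h1, h2, h3⟩ := h
  obtain ⟨m, rfl⟩ : ∃ m, i = j + m + 1 := ⟨i - 1 - j, by omega⟩
  have hd : G.NodeDiscriminating m (fun l => v (j + l)) := by
    refine ⟨⟨fun l hl => hp.1 (j + l) (by omega), fun l hl l' hl' he => ?_⟩, h2, fun l hl => ?_⟩
    · have := hp.2 _ (by omega) _ (by omega) he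
      omega
    · obtain ⟨h4, h5⟩ := h3 (j + l + 1) (by omega) (by omega)
      exact ⟨(hp.isCollider_iff (k := j + l) (by omega)).2 h4, h5⟩
  exact hd.ordered hG fun l hl => ho (j + l + 1) (by omega) (by omega)

theorem RightDisc.ordered {G : LMG V} (hG : G.IsSimple) {n i r : ℕ} {v : ℕ → V}
    (hp : G.IsNodePath n v) (hi : 0 < i) (h : G.RightDisc n v i r)
    (ho : ∀ k, i < k → k < r → G.Ordered (v (k - 1)) (v k) (v (k + 1))) :
    G.Ordered (v (i - 1)) (v i) (v (i + 1)) := by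
  obtain ⟨h1, h2, h3, h4⟩ := h
  have e : ∀ k, k ≤ n → n - (n - k) = k := by omega
  have hl : G.LeftDisc n (fun k => v (n - k)) (n - i) (n - r) := by
    have e1 : n - (n - i + 1) = i - 1 := by omega
    refine ⟨by omega, ?_, fun k hk hk' => ?_⟩
    · simp only [e1, e r h2]
      exact fun h => h3 h.symm
    · rw [colAt_reverse (by omega)]
      simp only [e1]
      exact h4 (n - k) (by omega) (by omega)
  have := hl.ordered hG hp.reverse (by omega) fun k hk hk' => by
    have := (ho (n - k) (by omega) (by omega)).symm
    simpa only [show n - (k - 1) = n - k + 1 by omega, show n - (k + 1) = n - k - 1 by omega]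
      using this
  simp only [e i (by omega), show n - (n - i + 1) = i - 1 by omega,
    show n - (n - i - 1) = i + 1 by omega] at this
  exact this.symm

/-- Suppose the two discriminating pieces overlap past each other. Acyclicity and the collider
arrowheads force them to span the same nodes, from `v (p - 1)` to `v (t + 1)`. All inner nodes are
then colliders and parents of one of the two ends, so the piece is an inducing path between
nonadjacent nodes. -/
theorem LeftDisc.le_of_rightDisc {G : LMG V} (hG : G.IsAncestral) (hm : G.IsMaximal) {n p r t j : ℕ}
    {v : ℕ → V} (hv : G.IsNodePath n v) (hp0 : 0 < p) (hr : G.RightDisc n v p r) (hpt : p < t)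
    (htr : t < r) (hl : G.LeftDisc n v t j) : p ≤ j := by
  by_contra hjp
  push Not at hjp
  obtain ⟨hr1, hr2, hr3, hr4⟩ := hr
  obtain ⟨hl1, hl2, hl3⟩ := hl
  obtain ⟨hpc, hpd⟩ := hl3 p hjp hpt
  obtain ⟨htc, htd⟩ := hr4 t hpt htr
  have hj : j = p - 1 := by
    by_contra hne
    exact hG.not_into_of_isAncestor ((isAncestor_of_dir htd).trans
      (isAncestor_of_dir (hl3 (p - 1) (by omega) (by omega)).2)) htc.2.2
  have hr : r = t + 1 := by
    by_contra hne
    exact hG.not_into_of_isAncestor ((isAncestor_of_dir hpd).trans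
      (isAncestor_of_dir (hr4 (t + 1) (by omega) (by omega)).2)) hpc.1.2
  subst hj hr
  obtain ⟨q, rfl⟩ : ∃ q, p = q + 1 := ⟨p - 1, by omega⟩
  simp only [Nat.add_sub_cancel] at *
  obtain ⟨l, rfl⟩ : ∃ l, t = q + l + 1 := ⟨t - q - 1, by omega⟩
  refine hr3 (hm _ _ (fun he => ?_) (hG.isSimple.inducingConnected_iff.2
    ⟨l + 2, fun k => v (q + k), ⟨⟨fun k hk => hv.1 (q + k) (by omega), ?_⟩, ?_⟩, rfl, rfl⟩))
  · have := hv.2 _ (by omega) _ (by omega) he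
    omega
  · intro k hk k' hk' he
    have := hv.2 _ (by omega) _ (by omega) he
    omega
  · intro k hk
    rcases (show k ≤ l by omega).lt_or_eq with h | rfl
    · obtain ⟨h1, h2⟩ := hl3 (q + k + 1) (by omega) (by omega)
      exact ⟨(hv.isCollider_iff (k := q + k) (by omega)).2 h1, .inr (isAncestor_of_dir h2)⟩
    · exact ⟨(hv.isCollider_iff (k := q + k) (by omega)).2 htc, .inl (isAncestor_of_dir htd)⟩

/-- All triples on a minimal connecting walk in a maximal ancestral graph have order. -/
theorem MinWalk.ordered {G : LMG V} (hG : G.IsAncestral) (hm : G.IsMaximal) {C : Set V} {n : ℕ}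
    {v : ℕ → V} {w : ℕ → ℕ} (h : G.MinWalk C n v w) {i : ℕ} (hi : 0 < i) (hin : i < n) :
    G.Ordered (v (i - 1)) (v i) (v (i + 1)) := by
  classical
  have hp := h.isNodePath hG
  let Bad : ℕ → Prop := fun k => 0 < k ∧ k < n ∧ ¬ G.Ordered (v (k - 1)) (v k) (v (k + 1))
  have hdisc : ∀ k, Bad k → (∃ j, G.LeftDisc n v k j) ∨ ∃ r, G.RightDisc n v k r := by
    rintro k ⟨h1, h2, h3⟩
    refine h.leftDisc_or_rightDisc hG h1 h2 (by_contra fun hadj => h3 ⟨0, ⟨?_, ?_, ?_⟩, hadj⟩)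
    · intro he
      have := hp.2 _ (by omega) _ (by omega) he
      omega
    · have := hp.1 (k - 1) (by omega)
      rwa [show k - 1 + 1 = k by omega] at this
    · exact hp.1 k h2
  have hleft : ∀ k j, Bad k → G.LeftDisc n v k j → ∃ l, j < l ∧ l < k ∧ Bad l := by
    rintro k j ⟨h1, h2, h3⟩ hl
    by_contra hcon
    push Not at hcon
    refine h3 (hl.ordered hG.isSimple hp h2 fun l hl hl' => by_contra fun ho => ?_)
    exact hcon l hl hl' ⟨by omega, by omega, ho⟩
  have hright : ∀ k r, Bad k → G.RightDisc n v k r → ∃ l, k < l ∧ l < r ∧ Bad l := by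
    rintro k r ⟨h1, h2, h3⟩ hl
    by_contra hcon
    push Not at hcon
    refine h3 (hl.ordered hG.isSimple hp h1 fun l hl' hl'' => by_contra fun ho => ?_)
    exact hcon l hl' hl'' ⟨by omega, by have := hl.2.1; omega, ho⟩
  by_contra hbad
  have hbad : Bad i := ⟨hi, hin, hbad⟩
  -- Take the rightmost bad `p` discriminated from the right, and the first bad `t` inside its
  -- piece. By the choice of `p`, `t` is discriminated from the left, by a piece starting no earlier
  -- than `p`; this contains a bad triple before `t`. If there is no such `p`, the first bad triple
  -- gives the contradiction.
  by_cases hex : ∃ p, Bad p ∧ ∃ r, G.RightDisc n v p r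
  · obtain ⟨p, ⟨hpb, r, hr⟩, hmax⟩ : ∃ p, (Bad p ∧ ∃ r, G.RightDisc n v p r) ∧
        ∀ q, (Bad q ∧ ∃ r, G.RightDisc n v q r) → q ≤ p := by
      have hle : ∀ q, (Bad q ∧ ∃ r, G.RightDisc n v q r) → q ≤ n := fun q hq => hq.1.2.1.le
      obtain ⟨q, hq⟩ := hex
      exact ⟨_, Nat.findGreatest_spec (P := fun q => Bad q ∧ ∃ r, G.RightDisc n v q r)
        (hle q hq) hq, fun q' hq' => Nat.le_findGreatest (hle q' hq') hq'⟩
    have hex' : ∃ t, p < t ∧ t < r ∧ Bad t := hright p r hpb hr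
    obtain ⟨h1, h2, h3⟩ := Nat.find_spec hex'
    rcases hdisc _ h3 with ⟨j, hj⟩ | hr'
    · have hpj := hj.le_of_rightDisc hG hm hp hpb.1 hr h1 h2
      obtain ⟨l, hl1, hl2, hl3⟩ := hleft _ _ h3 hj
      exact Nat.find_min hex' hl2 ⟨by omega, by omega, hl3⟩
    · have := hmax _ ⟨h3, hr'⟩
      omega
  · have hex' : ∃ t, Bad t := ⟨i, hbad⟩
    have h1 := Nat.find_spec hex'
    rcases hdisc _ h1 with ⟨j, hj⟩ | hr
    · obtain ⟨l, -, hl2, hl3⟩ := hleft _ _ h1 hj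
      exact Nat.find_min hex' hl2 hl3
    · exact hex ⟨_, h1, hr⟩

/-! ### Transfer of connecting walks -/

theorem sum_range_split (w : ℕ → ℕ) {n i : ℕ} (hi : i ≤ n) :
    ∑ l ∈ Finset.range (n + 1), w l =
      ∑ l ∈ Finset.range i, w l + w i + ∑ l ∈ Finset.range (n - i), w (n - l) := by
  obtain ⟨m, rfl⟩ : ∃ m, n = i + m := ⟨n - i, by omega⟩
  rw [show i + m + 1 = i + 1 + m by omega, Finset.sum_range_add, Finset.sum_range_succ,
    show i + m - i = m by omega, ← Finset.sum_range_reflect (fun l => w (i + 1 + l))]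
  congr 1
  refine Finset.sum_congr rfl fun l hl => ?_
  have := Finset.mem_range.1 hl
  congr 1
  omega

/-- Replacing only the directed walk used at `v i` keeps the number of edges, so total weights can
be compared. -/
theorem MinWalk.weight_le {G : LMG V} {C : Set V} {n : ℕ} {v : ℕ → V} {w : ℕ → ℕ}
    (h : G.MinWalk C n v w) {i k : ℕ} (hi : i ≤ n) (hc : G.ColAt n v i)
    (hk : G.DirDist C k (v i)) : w i ≤ k := by
  have := (h.min (h.toConnWalk.trail hi) (h.toConnWalk.trail_reverse hi)
    (.inl ⟨hc.1, hc.2, hk⟩)).2 (by omega)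
  rw [sum_range_split w hi] at this
  omega

/-- On a minimal connecting walk, the edge from a collider towards the conditioning set is the last
edge of a discriminating path. -/
theorem MinWalk.discriminating_of_dir {G : LMG V} (hG : G.IsAncestral) {C : Set V} {n : ℕ}
    {v : ℕ → V} {w : ℕ → ℕ} (h : G.MinWalk C n v w) {i k : ℕ} {d : V} (hi : i ≤ n)
    (hc : G.ColAt n v i) (hd : G.dir (v i) d) (hk : G.DirDist C k d) (hw : w i = k + 1) :
    (∃ j < i, ¬ G.Adj (v j) d ∧ ∀ l, j < l → l < i → G.ColAt n v l ∧ G.dir (v l) d) ∨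
      ∃ j < n - i, ¬ G.Adj (v (n - j)) d ∧ ∀ l, j < l → l < n - i →
        G.ColAt n (fun k => v (n - k)) l ∧ G.dir (v (n - l)) d := by
  have e : n - (n - i) = i := by omega
  have hin : G.InHead (fun k => v (n - k)) (n - i) := by
    rw [inHead_reverse (by omega), e]
    exact hc.2
  rcases h.toConnWalk.discriminating_or_trail hG hi hc.1 hd with h1 | ⟨j, hj, h1, h2⟩
  · exact .inl h1
  rcases h.toConnWalk.reverse.discriminating_or_trail hG (i := n - i) (by omega) hin
    (by simpa only [e] using hd) with h3 | ⟨j', hj', h3, h4⟩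
  · exact .inr h3
  exfalso
  simp only [Nat.sub_zero] at h4
  -- Redirecting both sides yields a walk through the collider `d`. Minimal length forces it to
  -- replace just `v i` by `d`, but then the weight drops from `k + 1` to `k`.
  obtain ⟨h5, h6⟩ := h.min h2 h4 (.inl ⟨h1, h3, hk⟩)
  obtain rfl : i = j + 1 := by omega
  have h6 := h6 (by omega)
  rw [sum_range_split w hi, show n - (j + 1) = j' + 1 by omega] at h6
  omega

/-- The piece from `v j` to `v i`, continued to `d`, discriminates `v i` in `G`, and its triples
have order. So it discriminates `v i` in `H` too, with the same noncollider. -/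
theorem AgreeOnDiscriminated.dir_transfer {G H : LMG V} (hG : G.IsAncestral) (hH : H.IsAncestral)
    (hadj : ∀ x y, G.Adj x y ↔ H.Adj x y) (hQ : G.AgreeOnDiscriminated H) {n : ℕ} {v : ℕ → V}
    (hp : G.IsNodePath n v)
    (ho : ∀ k, 0 < k → k < n → G.Ordered (v (k - 1)) (v k) (v (k + 1))) {i j : ℕ} {d : V}
    (hji : j < i) (hc : G.ColAt n v i) (hd : G.dir (v i) d) (hn : ¬ G.Adj (v j) d)
    (hl : ∀ l, j < l → l < i → G.ColAt n v l ∧ G.dir (v l) d) : H.dir (v i) d := by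
  obtain ⟨m, rfl⟩ : ∃ m, i = j + m + 1 := ⟨i - 1 - j, by omega⟩
  have hin : j + m + 1 < n := hc.2.1
  have hl' : ∀ l, j < l → l ≤ j + m + 1 → G.ColAt n v l ∧ G.dir (v l) d := fun l h1 h2 => by
    rcases h2.lt_or_eq with h2 | rfl
    exacts [hl l h1 h2, ⟨hc, hd⟩]
  have hpu : G.IsNodePath (m + 1) (fun l => v (j + l)) := by
    refine ⟨fun l hl => hp.1 (j + l) (by omega), fun l hl l' hl' he => ?_⟩
    have := hp.2 _ (by omega) _ (by omega) he
    omega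
  have hne : ∀ l ≤ m + 1, v (j + l) ≠ d := by
    rintro l hlm rfl
    rcases Nat.eq_zero_or_pos l with rfl | h0
    · obtain ⟨h1, h2⟩ := hl' (j + 1) (by omega) (by omega)
      exact hG.not_into_of_dir h2 h1.1.2
    · exact G.dir_irrefl _ (hl' (j + l) (by omega) (by omega)).2
  have hcol : ∀ l < m + 1, G.IsCollider (v (j + l)) (v (j + l + 1)) (v (j + l + 2)) :=
    fun l hlm => (hp.isCollider_iff (by omega)).2 (hl' (j + l + 1) (by omega) (by omega)).1
  have hdG := nodeDiscriminating_truncate hpu hne (adj_iff.2 (.inr (.inr (.inl hd)))) hn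
    fun l hlm => ⟨hcol l (by omega), (hl' (j + l + 1) (by omega) (by omega)).2⟩
  have hord : ∀ l < m + 1, G.Ordered (v (j + l)) (v (j + l + 1)) (v (j + l + 2)) :=
    fun l hlm => ho (j + l + 1) (by omega) (by omega)
  have htr : ∀ l < m + 1, H.Ordered (v (j + l)) (v (j + l + 1)) (v (j + l + 2)) ∧
      H.IsCollider (v (j + l)) (v (j + l + 1)) (v (j + l + 2)) := fun l hlm =>
    have := hQ.ordered hG hH hadj (hord l hlm)
    ⟨this.1, this.2.1 (hcol l hlm)⟩
  have hoG : ∀ l < m, G.Ordered (truncate (fun l => v (j + l)) (m + 1) d l)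
      (truncate (fun l => v (j + l)) (m + 1) d (l + 1))
      (truncate (fun l => v (j + l)) (m + 1) d (l + 2)) := fun l hlm => by
    rw [truncate_of_le (by omega), truncate_of_le (by omega), truncate_of_le (by omega)]
    exact hord l (by omega)
  have hoH : ∀ l < m, H.Ordered (truncate (fun l => v (j + l)) (m + 1) d l)
      (truncate (fun l => v (j + l)) (m + 1) d (l + 1))
      (truncate (fun l => v (j + l)) (m + 1) d (l + 2)) := fun l hlm => by
    rw [truncate_of_le (by omega), truncate_of_le (by omega), truncate_of_le (by omega)]
    exact (htr l (by omega)).1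
  have hdH := hdG.transfer hG hH hadj hQ hoG hoH fun l hlm => by
    rw [truncate_of_le (by omega), truncate_of_le (by omega), truncate_of_le (by omega)]
    exact (htr l (by omega)).2
  have hiff := hQ m _ hdG hdH hoG hoH
  rw [truncate_of_le (by omega), truncate_of_le (by omega), truncate_of_lt (by omega)] at hiff
  have hinto := (htr m (by omega)).2.2.1
  refine hH.dir_of_not_into hinto ((hadj _ _).1 (adj_iff.2 (.inr (.inr (.inl hd))))) fun hback => ?_
  exact hG.not_into_of_dir hd (hiff.2 ⟨hne m (by omega), hinto, hback⟩).2.2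

/-- A shortest directed path whose first edge is also in `H` is a directed path in `H`. -/
theorem AgreeOnDiscriminated.dirDist_transfer {G H : LMG V} (hG : G.IsAncestral)
    (hH : H.IsAncestral) (hadj : ∀ x y, G.Adj x y ↔ H.Adj x y) (hQ : G.AgreeOnDiscriminated H)
    {C : Set V} {k : ℕ} {b d : V} (hbd : G.dir b d) (hbd' : H.dir b d) (hk : G.DirDist C k d)
    (hmin : ∀ l, G.DirDist C l b → k + 1 ≤ l) : H.DirDist C (k + 1) b := by
  refine ⟨d, hbd', ?_⟩
  induction k generalizing b d with
  | zero => exact hk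
  | succ k ih =>
    obtain ⟨d', hd, hk'⟩ := hk
    have hanc := (isAncestor_of_dir hbd).trans (isAncestor_of_dir hd)
    -- By minimality the directed path has no chord `b → d'`, and any other edge contradicts
    -- ancestrality. So `d` is the middle of an unshielded noncollider, which `H` shares.
    have hn : ¬ G.Adj b d' := by
      intro h
      rcases adj_iff.1 h with h | h | h | h
      · exact hG.not_und_of_into (.inl hd) (G.und_symm h)
      · exact hG.not_into_of_isAncestor hanc (.inr (G.bi_symm h))
      · have := hmin (k + 1) ⟨d', h, hk'⟩
        omega
      · exact hG.not_into_of_isAncestor hanc (.inl h)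
    have hne : b ≠ d' := fun he => hG.no_directed_cycle b (by rwa [← he] at hanc)
    have hdd : G.Adj d d' := adj_iff.2 (.inr (.inr (.inl hd)))
    have htr := hQ.ordered hG hH hadj (i := b) (j := d) (k := d')
      ⟨0, ⟨hne, adj_iff.2 (.inr (.inr (.inl hbd))), hdd⟩, hn⟩
    have hd' : H.dir d d' := hH.dir_of_not_into (.inl hbd') ((hadj _ _).1 hdd) fun h' =>
      hG.not_into_of_dir hd (htr.2.2 ⟨hne, .inl hbd', h'⟩).2.2
    refine ⟨d', hd', ih hd hd' hk' fun l hl => ?_⟩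
    have := hmin (l + 1) ⟨d, hbd, hl⟩
    omega

/-- The nodes of a minimal walk of `G` already form a connecting path in `H`. The transferred
triples settle the collider status, and the transferred shortest directed paths keep the colliders
connected to `C`. -/
theorem AgreeOnDiscriminated.mConnected {G H : LMG V} (hG : G.IsAncestral) (hH : H.IsAncestral)
    (hm : G.IsMaximal) (hadj : ∀ x y, G.Adj x y ↔ H.Adj x y) (hQ : G.AgreeOnDiscriminated H)
    {C : Set V} {x y : V} (hxy : x ≠ y) (h : G.MConnected C x y) : H.MConnected C x y := by
  obtain ⟨n₀, v₀, w₀, rfl, rfl, h₀⟩ := (hG.mConnected_iff_exists_connWalk hxy).1 h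
  obtain ⟨n, v, w, h, e0, en⟩ := exists_minWalk h₀ hxy
  rw [← e0, ← en]
  have hp := h.isNodePath hG
  have ho : ∀ k, 0 < k → k < n → G.Ordered (v (k - 1)) (v k) (v (k + 1)) :=
    fun k h1 h2 => h.ordered hG hm h1 h2
  have hiff : ∀ k, k + 1 < n → (G.IsCollider (v k) (v (k + 1)) (v (k + 2)) ↔
      H.IsCollider (v k) (v (k + 1)) (v (k + 2))) := fun k hk =>
    (hQ.ordered hG hH hadj (ho (k + 1) (by omega) hk)).2
  obtain ⟨-, h1, h2, h3⟩ := h.toConnWalk.nodeConnecting hp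
  rw [hH.isSimple.mConnected_iff]
  refine ⟨n, v, rfl, rfl, hp.congr hadj, fun k hk hc => ?_,
    fun k hk hc => h2 k hk (mt (hiff k hk).1 hc), h3⟩
  have hcG := (hp.isCollider_iff hk).1 ((hiff k hk).2 hc)
  have hw := (h.pass (k + 1) hk.le).dirDist hcG.1 hcG.2
  have hmin := fun l => h.weight_le hk.le hcG (k := l)
  rcases hwk : w (k + 1) with _ | l
  · rw [hwk] at hw
    exact .inl hw
  · rw [hwk] at hw hmin
    obtain ⟨d, hd, hl⟩ := hw
    refine (hQ.dirDist_transfer hG hH hadj hd ?_ hl hmin).mem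
    rcases h.discriminating_of_dir hG hk.le hcG hd hl hwk with ⟨j, hj, h4, h5⟩ | ⟨j, hj, h4, h5⟩
    · exact hQ.dir_transfer hG hH hadj hp ho hj hcG hd h4 h5
    · have e : n - (n - (k + 1)) = k + 1 := by omega
      have := hQ.dir_transfer hG hH hadj hp.reverse (fun l h6 h7 => by
          have := (ho (n - l) (by omega) (by omega)).symm
          simpa only [show n - (l - 1) = n - l + 1 by omega,
            show n - (l + 1) = n - l - 1 by omega] using this) hj
        (by rw [colAt_reverse (by omega), e]; exact hcG) (by simpa only [e] using hd) h4 h5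
      simpa only [e] using this

/-- Maximal ancestral graphs are Markov equivalent if and only if they have the same adjacencies
and the same colliders with order. -/
theorem markovEquiv_iff_collidersWithOrder {G H : LMG V} (hG : G.IsAncestral) (hH : H.IsAncestral)
    (hGm : G.IsMaximal) (hHm : H.IsMaximal) :
    G.MarkovEquiv H ↔
      (∀ x y, G.Adj x y ↔ H.Adj x y) ∧ G.collidersWithOrder = H.collidersWithOrder := by
  constructor
  · intro h
    have hadj := h.adj_iff hG hH hGm hHm
    exact ⟨hadj, (h.agreeOnDiscriminated hG hH hGm).collidersWithOrder_eq hG hH hadj⟩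
  · rintro ⟨hadj, h⟩
    have hQ := agreeOnDiscriminated_of_collidersWithOrder_eq hG.isSimple hH.isSimple h
    rw [markovEquiv_iff]
    exact fun C x y hxy => ⟨hQ.mConnected hG hH hGm hadj hxy,
      hQ.symm.mConnected hH hG hHm (fun x y => (hadj x y).symm) hxy⟩

end LMG

namespace LMG

variable {V ι : Type*}

/-! ### Graphs that agree up to edges into noncolliders -/

/-- The graphs have the same adjacencies and colliders, and the same directed edges and ancestral
relations out of the central nodes of colliders. -/
structure Similar (G H : LMG V) : Prop where
  adj : ∀ x y, G.Adj x y ↔ H.Adj x y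
  col : ∀ a b c, G.IsCollider a b c ↔ H.IsCollider a b c
  dir : ∀ {a b c}, G.IsCollider a b c → ∀ d, G.dir b d ↔ H.dir b d
  anc : ∀ {a b c}, G.IsCollider a b c → ∀ d, G.IsAncestor b d ↔ H.IsAncestor b d

theorem Similar.symm {G H : LMG V} (h : G.Similar H) : H.Similar G :=
  ⟨fun x y => (h.adj x y).symm, fun a b c => (h.col a b c).symm,
    fun hc d => (h.dir ((h.col _ _ _).2 hc) d).symm,
    fun hc d => (h.anc ((h.col _ _ _).2 hc) d).symm⟩

theorem Similar.nodeConnecting {G H : LMG V} (h : G.Similar H) {C : Set V} {n : ℕ} {v : ℕ → V}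
    (hc : G.NodeConnecting C n v) : H.NodeConnecting C n v := by
  refine ⟨hc.1.congr h.adj, fun k hk hcol => ?_,
    fun k hk hcol => hc.2.2.1 k hk (mt (h.col _ _ _).1 hcol), hc.2.2.2⟩
  have hcol' := (h.col _ _ _).2 hcol
  refine (hc.2.1 k hk hcol').imp id ?_
  rintro ⟨z, hz, ha⟩
  exact ⟨z, hz, (h.anc hcol' z).1 ha⟩

theorem Similar.markovEquiv {G H : LMG V} (hG : G.IsSimple) (hH : H.IsSimple) (h : G.Similar H) :
    G.MarkovEquiv H := by
  rw [markovEquiv_iff]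
  intro C x y _
  rw [hG.mConnected_iff, hH.mConnected_iff]
  exact ⟨fun ⟨n, v, h0, hn, hc⟩ => ⟨n, v, h0, hn, h.nodeConnecting hc⟩,
    fun ⟨n, v, h0, hn, hc⟩ => ⟨n, v, h0, hn, h.symm.nodeConnecting hc⟩⟩

theorem Similar.nodeDiscriminating {G H : LMG V} (h : G.Similar H) {m : ℕ} {v : ℕ → V}
    (hd : G.NodeDiscriminating m v) : H.NodeDiscriminating m v :=
  ⟨hd.1.congr h.adj, mt (h.adj _ _).2 hd.2.1, fun k hk =>
    ⟨(h.col _ _ _).1 (hd.2.2 k hk).1, (h.dir (hd.2.2 k hk).1 _).1 (hd.2.2 k hk).2⟩⟩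

theorem Similar.tripleOfOrderLE {G H : LMG V} (hG : G.IsSimple) (hH : H.IsSimple)
    (h : G.Similar H) {t : ℕ} {i j k : V} (ht : G.TripleOfOrderLE t i j k) :
    H.TripleOfOrderLE t i j k := by
  induction t generalizing i j k with
  | zero =>
    exact ⟨⟨ht.1.1, (h.adj _ _).1 ht.1.2.1, (h.adj _ _).1 ht.1.2.2⟩, mt (h.adj _ _).2 ht.2⟩
  | succ t ih =>
    rcases ht with ht | ⟨m, v, e, h1, h2, h3⟩
    · exact .inl (ih ht)
    · obtain ⟨e', h1'⟩ := hH.exists_isDiscriminatingPath_iff.2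
        (h.nodeDiscriminating (hG.exists_isDiscriminatingPath_iff.1 ⟨e, h1⟩))
      exact .inr ⟨m, v, e', h1', fun l hl => ih (h2 l hl), h3⟩

theorem Similar.collidersWithOrder_eq {G H : LMG V} (hG : G.IsSimple) (hH : H.IsSimple)
    (h : G.Similar H) : G.collidersWithOrder = H.collidersWithOrder := by
  ext ⟨i, j, k⟩
  rw [mem_collidersWithOrder_iff, mem_collidersWithOrder_iff, h.col]
  exact and_congr_right fun _ => exists_congr fun t =>
    ⟨h.tripleOfOrderLE hG hH, h.symm.tripleOfOrderLE hH hG⟩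

/-! ### The ancestral version of the interventional graph -/

/-- The undirected edges of `ancestralInterventional`. -/
def ancestralInterventionalUnd (G : LMG V) (T : ι → Set V) :
    V ⊕ InterventionNode T → V ⊕ InterventionNode T → Prop
  | .inl i, .inl j => G.und i j
  | .inl i, .inr w => i ∈ T w.1 ∧ G.SelectionAdjacent i
  | .inr w, .inl j => j ∈ T w.1 ∧ G.SelectionAdjacent j
  | .inr _, .inr _ => False

/-- The directed edges of `ancestralInterventional`. -/
def ancestralInterventionalDir (G : LMG V) (T : ι → Set V) :
    V ⊕ InterventionNode T → V ⊕ InterventionNode T → Prop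
  | .inl i, .inl j => G.dir i j
  | .inr w, .inl j => j ∈ T w.1 ∧ ¬ G.SelectionAdjacent j
  | _, .inr _ => False

/-- The interventional graph, with the edges from interventional nodes to selection adjacent nodes
made undirected. This keeps the graph ancestral. -/
def ancestralInterventional (G : LMG V) (T : ι → Set V) : LMG (V ⊕ InterventionNode T) where
  und := G.ancestralInterventionalUnd T
  bi := liftRel T G.bi
  dir := G.ancestralInterventionalDir T
  und_symm := by
    rintro (i | i) (j | j) h
    · exact G.und_symm h
    all_goals exact h
  bi_symm := by
    rintro (i | i) (j | j) h
    · exact G.bi_symm h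
    all_goals exact h.elim
  und_irrefl := by
    rintro (i | i) h
    · exact G.und_irrefl i h
    · exact h
  bi_irrefl := by
    rintro (i | i) h
    · exact G.bi_irrefl i h
    · exact h
  dir_irrefl := by
    rintro (i | i) h
    · exact G.dir_irrefl i h
    · exact h

/-- `G` is the subgraph of `K` induced by the left summand, and no directed edge points to the right
summand. -/
structure Extends {W : Type*} (K : LMG (V ⊕ W)) (G : LMG V) : Prop where
  edge : ∀ κ i j, K.HasEdge κ (.inl i) (.inl j) ↔ G.HasEdge κ i j
  not_dir : ∀ x w, ¬ K.dir x (.inr w)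

section Extends

variable {W : Type*} {K : LMG (V ⊕ W)} {G : LMG V}

theorem Extends.dir_iff (h : K.Extends G) {i j : V} : K.dir (.inl i) (.inl j) ↔ G.dir i j :=
  h.edge .fwd i j

theorem Extends.into_iff (h : K.Extends G) {i j : V} : K.Into (.inl i) (.inl j) ↔ G.Into i j :=
  or_congr (h.edge .fwd i j) (h.edge .arc i j)

theorem Extends.adj_iff (h : K.Extends G) {i j : V} : K.Adj (.inl i) (.inl j) ↔ G.Adj i j :=
  exists_congr fun κ => h.edge κ i j

theorem Extends.isCollider_iff (h : K.Extends G) {i j k : V} :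
    K.IsCollider (.inl i) (.inl j) (.inl k) ↔ G.IsCollider i j k := by
  rw [LMG.isCollider_iff, LMG.isCollider_iff, h.into_iff, h.into_iff, ne_eq, Sum.inl.injEq]

theorem Extends.isNodePath_iff (h : K.Extends G) {n : ℕ} {v : ℕ → V} :
    K.IsNodePath n (fun k => .inl (v k)) ↔ G.IsNodePath n v := by
  simp only [IsNodePath, h.adj_iff, Sum.inl.injEq]

theorem Extends.not_isAncestor (h : K.Extends G) {x : V ⊕ W} {w : W} :
    ¬ K.IsAncestor x (.inr w) := by
  intro ha
  obtain ⟨p, -, hp⟩ := Relation.TransGen.tail'_iff.1 ha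
  exact h.not_dir _ _ hp

theorem Extends.isAncestor_iff (h : K.Extends G) {i j : V} :
    K.IsAncestor (.inl i) (.inl j) ↔ G.IsAncestor i j := by
  constructor
  · suffices ∀ x, K.IsAncestor (.inl i) x → ∀ j, x = .inl j → G.IsAncestor i j from
      fun ha => this _ ha _ rfl
    intro x hx
    induction hx with
    | single hd =>
      rintro j rfl
      exact isAncestor_of_dir (h.dir_iff.1 hd)
    | @tail y z hy hd ih =>
      rintro j rfl
      rcases y with k | w
      · exact (ih k rfl).trans (isAncestor_of_dir (h.dir_iff.1 hd))
      · exact (h.not_isAncestor hy).elim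
  · intro ha
    exact Relation.TransGen.lift Sum.inl (fun _ _ => h.dir_iff.2) _ _ ha

theorem Extends.nodeInducing_iff (h : K.Extends G) {n : ℕ} {v : ℕ → V} :
    K.NodeInducing n (fun k => .inl (v k)) ↔ G.NodeInducing n v := by
  simp only [NodeInducing, h.isNodePath_iff, h.isCollider_iff, h.isAncestor_iff]

theorem Extends.nodeDiscriminating_iff (h : K.Extends G) {m : ℕ} {v : ℕ → V} :
    K.NodeDiscriminating m (fun k => .inl (v k)) ↔ G.NodeDiscriminating m v := by
  simp only [NodeDiscriminating, h.isNodePath_iff, h.adj_iff, h.isCollider_iff, h.dir_iff]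

theorem Extends.ordered (h : K.Extends G) (hK : K.IsSimple) (hG : G.IsSimple) {i j k : V}
    (ho : G.Ordered i j k) : K.Ordered (.inl i) (.inl j) (.inl k) := by
  obtain ⟨t, ho⟩ := ho
  refine ⟨t, ?_⟩
  induction t generalizing i j k with
  | zero =>
    exact ⟨⟨fun he => ho.1.1 (Sum.inl.inj he), h.adj_iff.2 ho.1.2.1, h.adj_iff.2 ho.1.2.2⟩,
      mt h.adj_iff.1 ho.2⟩
  | succ t ih =>
    rcases ho with ho | ⟨m, v, e, h1, h2, h3⟩
    · exact .inl (ih ho)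
    · obtain ⟨e', h1'⟩ := hK.exists_isDiscriminatingPath_iff.2
        (h.nodeDiscriminating_iff.2 (hG.exists_isDiscriminatingPath_iff.1 ⟨e, h1⟩))
      refine .inr ⟨m, _, e', h1', fun l hl => ih (h2 l hl), ?_⟩
      rcases h3 with ⟨rfl, rfl, rfl⟩ | ⟨rfl, rfl, rfl⟩
      · exact .inl ⟨rfl, rfl, rfl⟩
      · exact .inr ⟨rfl, rfl, rfl⟩

end Extends

theorem interventional_extends (G : LMG V) (T : ι → Set V) : (G.interventional T).Extends G := by
  refine ⟨fun κ i j => by cases κ <;> rfl, ?_⟩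
  rintro (x | x) w h <;> exact h

theorem ancestralInterventional_extends (G : LMG V) (T : ι → Set V) :
    (G.ancestralInterventional T).Extends G := by
  refine ⟨fun κ i j => by cases κ <;> rfl, ?_⟩
  rintro (x | x) w h <;> exact h

theorem interventional_isSimple {G : LMG V} (hG : G.IsSimple) (T : ι → Set V) :
    (G.interventional T).IsSimple := by
  have hE := interventional_extends G T
  rintro (u | u) (v | v) κ κ' h h'
  · exact hG ((hE.edge _ _ _).1 h) ((hE.edge _ _ _).1 h')
  all_goals cases κ <;> cases κ' <;> first | rfl | exact h.elim | exact h'.elim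

theorem ancestralInterventional_isAncestral {G : LMG V} (hG : G.IsAncestral) (T : ι → Set V) :
    (G.ancestralInterventional T).IsAncestral := by
  have hE := ancestralInterventional_extends G T
  refine ⟨?_, ?_, ?_⟩
  · rintro (i | w) h
    · exact hG.no_directed_cycle i (hE.isAncestor_iff.1 h)
    · exact hE.not_isAncestor h
  · rintro (i | i) (j | j) h
    · rw [hE.isAncestor_iff, hE.isAncestor_iff]
      exact hG.bi_no_directed_path i j h
    all_goals exact h.elim
  · have key : ∀ x y, (G.ancestralInterventional T).und x y → ∀ z,
        ¬ (G.ancestralInterventional T).dir z x ∧ ¬ (G.ancestralInterventional T).bi z x := by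
      have hinl : ∀ i, G.SelectionAdjacent i → ∀ z, ¬ (G.ancestralInterventional T).dir z (.inl i) ∧
          ¬ (G.ancestralInterventional T).bi z (.inl i) := by
        rintro i hs (k | w)
        · obtain ⟨j, hj⟩ := hs
          exact ⟨(hG.und_no_arrowhead i j hj k).1, (hG.und_no_arrowhead i j hj k).2.1⟩
        · exact ⟨fun h => h.2 hs, fun h => h⟩
      rintro (i | w) (j | w') h
      · exact hinl i ⟨j, h⟩
      · exact hinl i h.2
      all_goals
        rintro (k | k)
        · exact ⟨fun h => h, fun h => h⟩
        · exact ⟨fun h => h, fun h => h⟩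
    intro x y h z
    have h1 := key x y h z
    have h2 := key y x ((G.ancestralInterventional T).und_symm h) z
    exact ⟨h1.1, h1.2, h2.1, h2.2⟩

/-- Only edges into selection-adjacent nodes are reoriented. Such a node is never a collider: an
arrowhead from `G` is excluded by its undirected edge, and two from interventional nodes by `hT`. -/
theorem interventional_similar {G : LMG V} (hG : G.IsAncestral) {T : ι → Set V}
    (hT : ∀ i, G.SelectionAdjacent i → ¬ DoublyIntervenes T i) :
    (G.interventional T).Similar (G.ancestralInterventional T) := by
  have hE := interventional_extends G T
  have hE' := ancestralInterventional_extends G T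
  have hdir : ∀ (b : V) d, (G.interventional T).dir (.inl b) d ↔
      (G.ancestralInterventional T).dir (.inl b) d := by
    rintro b (d | d) <;> rfl
  have hinl : ∀ {a b c}, (G.interventional T).IsCollider a b c → ∃ i, b = .inl i := by
    rintro (a | a) (b | b) (c | c) ⟨-, h, -⟩
    all_goals first | exact ⟨b, rfl⟩ | exact (h.elim id id).elim
  have hinto : ∀ {a b}, (G.ancestralInterventional T).Into a b → (G.interventional T).Into a b := by
    rintro (a | a) (b | b) h
    · exact h
    · exact h
    · exact h.imp (fun h => h.1) id
    · exact h
  have hsel : ∀ {a b c}, (G.interventional T).IsCollider a (.inl b) c →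
      ¬ G.SelectionAdjacent b := by
    rintro a b c ⟨hac, h1, h2⟩ hs
    have hno : ∀ z, ¬ G.Into z b := fun z hz => by
      obtain ⟨j, hj⟩ := hs
      exact hG.not_und_of_into hz hj
    rcases a with a | a
    · exact hno a h1
    rcases c with c | c
    · exact hno c h2
    refine hT b hs ⟨a.1, c.1, fun he => hac ?_, h1.elim id False.elim, h2.elim id False.elim⟩
    rw [Subtype.ext he]
  refine ⟨?_, ?_, ?_, ?_⟩
  · rintro (x | x) (y | y)
    · rw [hE.adj_iff, hE'.adj_iff]
    · rw [LMG.adj_iff, LMG.adj_iff]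
      change False ∨ False ∨ False ∨ x ∈ T y.1 ↔ (x ∈ T y.1 ∧ G.SelectionAdjacent x) ∨ False ∨
        False ∨ (x ∈ T y.1 ∧ ¬ G.SelectionAdjacent x)
      tauto
    · rw [LMG.adj_iff, LMG.adj_iff]
      change False ∨ False ∨ y ∈ T x.1 ∨ False ↔ (y ∈ T x.1 ∧ G.SelectionAdjacent y) ∨ False ∨
        (y ∈ T x.1 ∧ ¬ G.SelectionAdjacent y) ∨ False
      tauto
    · rw [LMG.adj_iff, LMG.adj_iff]
      rfl
  · intro a b c
    refine ⟨fun h => ?_, fun h => ⟨h.1, hinto h.2.1, hinto h.2.2⟩⟩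
    obtain ⟨i, rfl⟩ := hinl h
    have hs := hsel h
    have hinto' : ∀ a, (G.interventional T).Into a (.inl i) →
        (G.ancestralInterventional T).Into a (.inl i) := by
      rintro (a | a) h
      · exact h
      · exact h.imp (fun h => ⟨h, hs⟩) id
    exact ⟨h.1, hinto' a h.2.1, hinto' c h.2.2⟩
  · intro a b c h d
    obtain ⟨i, rfl⟩ := hinl h
    exact hdir i d
  · intro a b c h d
    obtain ⟨i, rfl⟩ := hinl h
    rcases d with d | d
    · rw [hE.isAncestor_iff, hE'.isAncestor_iff]
    · exact ⟨fun h => (hE.not_isAncestor h).elim, fun h => (hE'.not_isAncestor h).elim⟩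

theorem eq_of_edges_eq {G H : LMG V} (h1 : G.und = H.und) (h2 : G.bi = H.bi)
    (h3 : G.dir = H.dir) : G = H := by
  cases G
  cases H
  subst h1 h2 h3
  rfl

/-- Taking the maximal extension commutes with adding interventional nodes. -/
theorem ancestralInterventional_maximalExtension {G : LMG V} (hG : G.IsAncestral)
    (T : ι → Set V) : G.maximalExtension.ancestralInterventional T =
      (G.ancestralInterventional T).maximalExtension := by
  have hE := ancestralInterventional_extends G T
  have hK := ancestralInterventional_isAncestral hG T
  have key : ∀ x y, x ≠ y → ¬ (G.ancestralInterventional T).Adj x y →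
      (G.ancestralInterventional T).InducingConnected x y →
      ∃ i j, x = .inl i ∧ y = .inl j ∧ G.InducingConnected i j := by
    intro x y hne hadj hind
    obtain ⟨n, v, h, rfl, rfl⟩ := hK.isSimple.inducingConnected_iff.1 hind
    have hn := h.two_le hne hadj
    -- Inducing paths of length at least two are bidirected throughout, and no bidirected edge meets
    -- an interventional node. So such a path lies in `G`.
    have hbi : ∀ x y, (G.ancestralInterventional T).bi x y → (∃ i, x = .inl i) ∧ ∃ i, y = .inl i := by
      rintro (x | x) (y | y) h
      · exact ⟨⟨x, rfl⟩, ⟨y, rfl⟩⟩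
      all_goals exact h.elim
    have hinl : ∀ k, ∃ i, k ≤ n → v k = .inl i := by
      intro k
      rcases Nat.lt_or_ge k n with hk | hk
      · exact (hbi _ _ (h.bi hK hn hk)).1.imp fun i hi _ => hi
      · have h1 := (hbi _ _ (h.bi hK hn (k := n - 1) (by omega))).2
        rw [show n - 1 + 1 = n by omega] at h1
        exact h1.imp fun i hi hk' => by rwa [show k = n by omega]
    choose u hu using hinl
    refine ⟨u 0, u n, hu 0 (by omega), hu n le_rfl, hG.isSimple.inducingConnected_iff.2
      ⟨n, u, hE.nodeInducing_iff.1 ⟨⟨fun k hk => ?_, fun k hk l hl he => ?_⟩, fun k hk => ?_⟩,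
        rfl, rfl⟩⟩
    · beta_reduce
      rw [← hu k hk.le, ← hu (k + 1) hk]
      exact h.1.1 k hk
    · beta_reduce at he
      rw [← hu k hk, ← hu l hl] at he
      exact h.1.2 k hk l hl he
    · have := h.2 k hk
      rwa [hu k (by omega), hu (k + 1) (by omega), hu (k + 2) (by omega), hu 0 (by omega),
        hu n le_rfl] at this
  refine eq_of_edges_eq ?_ ?_ ?_
  · funext x y
    rcases x with x | x <;> rcases y with y | y <;> rfl
  · funext x y
    refine propext ⟨fun h => ?_, fun h => ?_⟩
    · rcases x with x | x <;> rcases y with y | y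
      · rcases h with h | ⟨h1, h2, h3⟩
        · exact .inl h
        · refine .inr ⟨fun he => h1 (Sum.inl.inj he), mt hE.adj_iff.1 h2, ?_⟩
          obtain ⟨n, v, h, rfl, rfl⟩ := hG.isSimple.inducingConnected_iff.1 h3
          exact hK.isSimple.inducingConnected_iff.2
            ⟨n, _, hE.nodeInducing_iff.2 h, rfl, rfl⟩
      all_goals exact h.elim
    · rcases h with h | ⟨h1, h2, h3⟩
      · rcases x with x | x <;> rcases y with y | y
        · exact .inl h
        all_goals exact h
      · obtain ⟨i, j, rfl, rfl, h4⟩ := key x y h1 h2 h3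
        exact .inr ⟨fun he => h1 (congrArg _ he), mt hE.adj_iff.2 h2, h4⟩
  · funext x y
    rcases x with x | x <;> rcases y with y | y <;> rfl

/-! ### Interventional Markov equivalence -/

theorem interventional_markovEquiv {G : LMG V} (hG : G.IsAncestral) {T : ι → Set V}
    (hT : ∀ i, G.SelectionAdjacent i → ¬ DoublyIntervenes T i) :
    (G.interventional T).MarkovEquiv (G.ancestralInterventional T) :=
  (interventional_similar hG hT).markovEquiv (interventional_isSimple hG.isSimple T)
    (ancestralInterventional_isAncestral hG T).isSimple

theorem interventional_markovEquiv_maximalExtension {G : LMG V} (hG : G.IsAncestral)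
    {T : ι → Set V} (hT : ∀ i, G.SelectionAdjacent i → ¬ DoublyIntervenes T i) :
    (G.interventional T).MarkovEquiv (G.maximalExtension.interventional T) := by
  have h1 := interventional_markovEquiv hG hT
  -- The extension has the same undirected edges, so `hT` applies to it by unfolding.
  have h2 := interventional_markovEquiv (G := G.maximalExtension)
    (maximalExtension_isAncestral hG) hT
  rw [ancestralInterventional_maximalExtension hG] at h2
  have h3 := markovEquiv_maximalExtension (ancestralInterventional_isAncestral hG T)
  exact (h1.trans h3).trans h2.symm

/-- Colliders with order of `G` keep their order in the interventional graph, so the removed set was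
a subset and can be added back. -/
theorem collidersWithOrder_interventional {G : LMG V} (hG : G.IsSimple) (T : ι → Set V) :
    (G.interventional T).collidersWithOrder = G.ICollidersWithOrder T ∪
      (fun x : V × V × V => (Sum.inl x.1, Sum.inl x.2.1, Sum.inl x.2.2)) ''
        G.collidersWithOrder := by
  rw [ICollidersWithOrder, Set.sdiff_union_of_subset]
  rintro _ ⟨⟨i, j, k⟩, h, rfl⟩
  rw [mem_collidersWithOrder_iff] at h
  have hE := interventional_extends G T
  exact mem_collidersWithOrder_iff.2 ⟨hE.isCollider_iff.2 h.1,
    hE.ordered (interventional_isSimple hG T) hG h.2⟩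

theorem interventional_adj_iff {G H : LMG V} {T : ι → Set V} :
    (∀ x y, (G.interventional T).Adj x y ↔ (H.interventional T).Adj x y) ↔
      ∀ x y, G.Adj x y ↔ H.Adj x y := by
  have hG := interventional_extends G T
  have hH := interventional_extends H T
  constructor
  · intro h x y
    rw [← hG.adj_iff, ← hH.adj_iff, h]
  · rintro h (x | x) (y | y)
    · rw [hG.adj_iff, hH.adj_iff, h]
    all_goals
      rw [LMG.adj_iff, LMG.adj_iff]
      rfl

/-- Restricting the colliders with order to `V` would not do, as discriminating paths through
interventional nodes may give order to further triples. Discriminating paths common to both graphs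
do lift with their ordered triples, and agreement on these is enough. -/
theorem agreeOnDiscriminated_of_interventional {G H : LMG V} (hG : G.IsSimple) (hH : H.IsSimple)
    {T : ι → Set V}
    (h : (G.interventional T).collidersWithOrder = (H.interventional T).collidersWithOrder) :
    G.AgreeOnDiscriminated H := by
  intro m v hdG hdH hoG hoH
  have hE := interventional_extends G T
  have hE' := interventional_extends H T
  have hG' := interventional_isSimple hG T
  have hH' := interventional_isSimple hH T
  have := agreeOnDiscriminated_of_collidersWithOrder_eq hG' hH' h m _
    (hE.nodeDiscriminating_iff.2 hdG) (hE'.nodeDiscriminating_iff.2 hdH)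
    (fun l hl => hE.ordered hG' hG (hoG l hl)) (fun l hl => hE'.ordered hH' hH (hoH l hl))
  rwa [hE.isCollider_iff, hE'.isCollider_iff] at this

/-- Interventional Markov equivalence of maximal extensions in terms of adjacencies and colliders
with order. -/
theorem iMarkovEquiv_maximalExtension_iff {G H : LMG V} (hG : G.IsAncestral) (hH : H.IsAncestral)
    {T : ι → Set V} (hGT : ∀ i, G.SelectionAdjacent i → ¬ DoublyIntervenes T i)
    (hHT : ∀ i, H.SelectionAdjacent i → ¬ DoublyIntervenes T i) :
    IMarkovEquiv T G.maximalExtension H.maximalExtension ↔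
      (∀ x y, G.maximalExtension.Adj x y ↔ H.maximalExtension.Adj x y) ∧
        (G.maximalExtension.interventional T).collidersWithOrder =
          (H.maximalExtension.interventional T).collidersWithOrder := by
  have hGe := maximalExtension_isAncestral hG
  have hHe := maximalExtension_isAncestral hH
  have hGK := ancestralInterventional_isAncestral hGe T
  have hHK := ancestralInterventional_isAncestral hHe T
  have hGm : (G.maximalExtension.ancestralInterventional T).IsMaximal := by
    rw [ancestralInterventional_maximalExtension hG]
    exact maximalExtension_isMaximal (ancestralInterventional_isAncestral hG T)
  have hHm : (H.maximalExtension.ancestralInterventional T).IsMaximal := by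
    rw [ancestralInterventional_maximalExtension hH]
    exact maximalExtension_isMaximal (ancestralInterventional_isAncestral hH T)
  have hGs := interventional_similar (G := G.maximalExtension) hGe hGT
  have hHs := interventional_similar (G := H.maximalExtension) hHe hHT
  have hGi := interventional_isSimple hGe.isSimple T
  have hHi := interventional_isSimple hHe.isSimple T
  have e1 : IMarkovEquiv T G.maximalExtension H.maximalExtension ↔
      (G.maximalExtension.ancestralInterventional T).MarkovEquiv
        (H.maximalExtension.ancestralInterventional T) := by
    rw [IMarkovEquiv, MarkovEquiv, hGs.markovEquiv hGi hGK.isSimple,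
      hHs.markovEquiv hHi hHK.isSimple]
  rw [e1, markovEquiv_iff_collidersWithOrder hGK hHK hGm hHm, hGs.collidersWithOrder_eq hGi
    hGK.isSimple, hHs.collidersWithOrder_eq hHi hHK.isSimple, ← interventional_adj_iff (T := T)]
  simp only [hGs.adj, hHs.adj]

end LMG

/-! ### Equivalence of the three conditions -/

theorem mainTheorem1 {V ι : Type*} [Finite V] [Finite ι] (G H : LMG V)
    (hG : G.IsAncestral) (hH : H.IsAncestral) (T : ι → Set V)
    (hGT : ∀ i, G.SelectionAdjacent i → ¬ LMG.DoublyIntervenes T i)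
    (hHT : ∀ i, H.SelectionAdjacent i → ¬ LMG.DoublyIntervenes T i) :
    List.TFAE [
      LMG.IMarkovEquiv T G H,
      LMG.IMarkovEquiv T G.maximalExtension H.maximalExtension,
      LMG.MarkovEquiv G.maximalExtension H.maximalExtension ∧
        G.maximalExtension.ICollidersWithOrder T = H.maximalExtension.ICollidersWithOrder T] := by
  have hGe := LMG.maximalExtension_isAncestral hG
  have hHe := LMG.maximalExtension_isAncestral hH
  have hmarkov := LMG.markovEquiv_iff_collidersWithOrder hGe hHe
    (LMG.maximalExtension_isMaximal hG) (LMG.maximalExtension_isMaximal hH)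
  have hiff := LMG.iMarkovEquiv_maximalExtension_iff hG hH hGT hHT
  tfae_have 1 ↔ 2 := by
    rw [LMG.IMarkovEquiv, LMG.IMarkovEquiv,
      LMG.interventional_markovEquiv_maximalExtension hG hGT,
      LMG.interventional_markovEquiv_maximalExtension hH hHT]
  tfae_have 2 → 3 := by
    intro h
    obtain ⟨hadj, hc⟩ := hiff.1 h
    have hc' := (LMG.agreeOnDiscriminated_of_interventional hGe.isSimple hHe.isSimple
      hc).collidersWithOrder_eq hGe hHe hadj
    exact ⟨hmarkov.2 ⟨hadj, hc'⟩, by rw [LMG.ICollidersWithOrder, LMG.ICollidersWithOrder, hc, hc']⟩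
  tfae_have 3 → 2 := by
    rintro ⟨h, hI⟩
    obtain ⟨hadj, hc⟩ := hmarkov.1 h
    refine hiff.2 ⟨hadj, ?_⟩
    rw [LMG.collidersWithOrder_interventional hGe.isSimple,
      LMG.collidersWithOrder_interventional hHe.isSimple, hI, hc]
  tfae_finish
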